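/- Let $n\ge 3$, $m\ge 1$, $r\ge 1$ be integers, let $\varepsilon_1,\dots,\varepsilon_n\in\{1,-1\}$ and let $g=\sum_i\varepsilon_i\,dx_i^2$ be the corresponding pseudo-Euclidean metric on $\mathbb{R}^n$. Let $\alpha\in\mathbb{R}^n$ satisfy $\sum_i\varepsilon_i\alpha_i^2=\varepsilon_{i_0}$ for some $i_0$, and put $\xi=\sum_i\alpha_i x_i$. Let $k>0$, $c>0$, $a=(n-2)k-m$, $b=m(2k+1)-(n-2)k^2$ and $$v(z)=\frac{r(a-rz)}{r(r-1)z^2-2r(k+a)z+a^2-b}.$$ Let $J\subseteq\mathbb{R}$ be an open interval and let $x,z:J\to\mathbb{R}$ be functions such that $z$ is differentiable and not constant, the denominator of $v$ does not vanish on $z(J)$, and, for some antiderivative $\int v(z)\,dz$ of $v$ on $z(J)$, $$v(z)\,z'-c(a-rz)\,e^{\int v(z)dz}=0,\qquad x=c\,e^{\int v(z)dz}\qquad\text{on } J.$$ Let $f,\varphi,h:J\to\mathbb{R}$ be smooth functions with $f>0$, $h>0$, $\varphi\ne 0$ and $$\frac{f'}{f}=x,\qquad \frac{\varphi'}{\varphi}=kx,\qquad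 \frac{h'}{h}=xz\qquad\text{on } J.$$ On the open set $U=\{p\in\mathbb{R}^n:\xi(p)\in J\}$ regard $f,\varphi,h$ as functions of $\xi$ and put $\overline g=\varphi^{-2}g$. Let $(F_1,g_{F_1})$ be a Ricci-flat semi-Riemannian manifold of dimension $m$, and let $B=U\times_f F_1$ be the warped product, with the metric $g_B=\overline g\oplus f^2g_{F_1}$. Then there is a constant $\mu\in\mathbb{R}$ with $$h\,\Delta_{g_B}h+(r-1)\,|\mathrm{grad}_{g_B}h|^2=\mu\qquad\text{on } B,$$ and, for every semi-Riemannian manifold $(F_2,g_{F_2})$ of dimension $r$ that is Einstein with $\mathrm{Ric}_{g_{F_2}}=\mu\,g_{F_2}$, the warped product $(U\times_f F_1)\times_h F_2$ with the metric $\widetilde g=(\overline g\oplus f^2g_{F_1})\oplus h^2g_{F_2}$ is a Ricci-flat semi-Riemannian manifold (that is, an Einstein manifold with $\mathrm{Ric}_{\widetilde g}=0$). -/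

import Mathlib

set_option maxSynthPendingDepth 3

open scoped Manifold ContDiff

noncomputable section

/-! ### Levi-Civita calculus of a metric on an open subset of a finite dimensional vector space

`G y` is the metric at the point `y`, as a bilinear form; `(G y).inverse` is the musical
isomorphism from covectors to vectors. -/

section Local

variable {E : Type*} [NormedAddCommGroup E] [NormedSpace ℝ E]

/-- The map `(u, v) ↦ D_u G (v, ·) + D_v G (u, ·) - D_· G (u, v)` at the point `y`. -/
def koszul (G : E → E →L[ℝ] E →L[ℝ] ℝ) (y : E) : E →L[ℝ] E →L[ℝ] (E →L[ℝ] ℝ) :=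
  fderiv ℝ G y + (fderiv ℝ G y).flip -
    (ContinuousLinearMap.flipₗᵢ ℝ E E ℝ : (E →L[ℝ] E →L[ℝ] ℝ) →L[ℝ] (E →L[ℝ] E →L[ℝ] ℝ)) ∘L
      (fderiv ℝ G y).flip

/-- The Christoffel symbols: `G (Γ(u, v), w) = (D_u G (v, w) + D_v G (u, w) - D_w G (u, v)) / 2`. -/
def christoffel (G : E → E →L[ℝ] E →L[ℝ] ℝ) (y : E) : E →L[ℝ] E →L[ℝ] E :=
  (ContinuousLinearMap.compL ℝ E (E →L[ℝ] ℝ) E (G y).inverse) ∘L ((1 / 2 : ℝ) • koszul G y)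

/-- The endomorphism `u ↦ R(u, v) w = ∇_u ∇_v w - ∇_v ∇_u w` (constant fields `u`, `v`, `w`). -/
def curvatureEnd (G : E → E →L[ℝ] E →L[ℝ] ℝ) (y v w : E) : E →L[ℝ] E :=
  ((fderiv ℝ (christoffel G) y).flip v).flip w - (fderiv ℝ (christoffel G) y v).flip w +
    (christoffel G y).flip (christoffel G y v w) -
    (christoffel G y v) ∘L ((christoffel G y).flip w)

/-- The Ricci tensor `Ric(v, w) = tr (u ↦ R(u, v) w)`. -/
def localRicci (G : E → E →L[ℝ] E →L[ℝ] ℝ) (y v w : E) : ℝ :=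
  LinearMap.trace ℝ E (curvatureEnd G y v w : E →ₗ[ℝ] E)

/-- The Hessian `Hess h (u, v) = D²h (u, v) - Dh (Γ(u, v))`. -/
def localHessian (G : E → E →L[ℝ] E →L[ℝ] ℝ) (h : E → ℝ) (y : E) : E →L[ℝ] E →L[ℝ] ℝ :=
  fderiv ℝ (fderiv ℝ h) y -
    (ContinuousLinearMap.compL ℝ E E ℝ (fderiv ℝ h y)) ∘L christoffel G y

/-- The Laplacian, the metric trace of the Hessian. -/
def localLaplacian (G : E → E →L[ℝ] E →L[ℝ] ℝ) (h : E → ℝ) (y : E) : ℝ :=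
  LinearMap.trace ℝ E (((G y).inverse ∘L localHessian G h y : E →L[ℝ] E) : E →ₗ[ℝ] E)

/-- The square `G(grad h, grad h) = Dh (grad h)` of the gradient. -/
def localGradSq (G : E → E →L[ℝ] E →L[ℝ] ℝ) (h : E → ℝ) (y : E) : ℝ :=
  fderiv ℝ h y ((G y).inverse (fderiv ℝ h y))

end Local

/-! ### Semi-Riemannian metrics on manifolds -/

section Manifold

variable {E : Type*} [NormedAddCommGroup E] [NormedSpace ℝ E]
  {H : Type*} [TopologicalSpace H]
  {E' : Type*} [NormedAddCommGroup E'] [NormedSpace ℝ E']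
  {H' : Type*} [TopologicalSpace H']

/-- A field of bilinear forms on the tangent spaces of `M`. In Mathlib, the tangent space
`TangentSpace I p` of a manifold modelled on `E` is by definition `E`, the identification with `E`
being the derivative of the preferred chart at `p`. -/
@[nolint unusedArguments]
abbrev BilinField (_I : ModelWithCorners ℝ E H) (M : Type*) : Type _ :=
  M → E →L[ℝ] E →L[ℝ] ℝ

/-- The derivative `dΦ_p` of a map of manifolds, the tangent spaces being seen as the model
vector spaces `E` and `E'`. -/
def tangentDeriv (I : ModelWithCorners ℝ E H) (I' : ModelWithCorners ℝ E' H')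
    {M : Type*} [TopologicalSpace M] [ChartedSpace H M]
    {M' : Type*} [TopologicalSpace M'] [ChartedSpace H' M']
    (Φ : M → M') (p : M) : E →L[ℝ] E' := mfderiv I I' Φ p

/-- The pullback `(Φ^* g)_p (u, v) = g_{Φ p} (dΦ_p u, dΦ_p v)`. -/
def pullbackField (I : ModelWithCorners ℝ E H) (I' : ModelWithCorners ℝ E' H')
    {M : Type*} [TopologicalSpace M] [ChartedSpace H M]
    {M' : Type*} [TopologicalSpace M'] [ChartedSpace H' M']
    (Φ : M → M') (g : BilinField I' M') : BilinField I M := fun p =>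
  (g (Φ p)).bilinearComp (tangentDeriv I I' Φ p) (tangentDeriv I I' Φ p)

variable (I : ModelWithCorners ℝ E H) {M : Type*} [TopologicalSpace M] [ChartedSpace H M]

/-- The expression of `g` in the preferred chart at `p`. -/
def coordField (g : BilinField I M) (p : M) : E → E →L[ℝ] E →L[ℝ] ℝ :=
  pullbackField 𝓘(ℝ, E) I (extChartAt I p).symm g

/-- `g` is a semi-Riemannian metric: smooth, symmetric, nondegenerate, of constant index. -/
structure IsSemiRiemannian (g : BilinField I M) : Prop where
  symm : ∀ p u v, g p u v = g p v u
  nondegenerate : ∀ p u, (∀ v, g p u v = 0) → u = 0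
  smooth : ∀ p, ContDiffOn ℝ ∞ (coordField I g p) (extChartAt I p).target
  constant_index : ∃ ν : ℕ, ∀ p,
    sigNeg (LinearMap.BilinMap.toQuadraticMap (g p).toLinearMap₁₂) = ν

/-- The Ricci tensor of `g` at `p`, computed in the preferred chart at `p`. -/
def ricci (g : BilinField I M) (p : M) (v w : E) : ℝ :=
  localRicci (coordField I g p) (extChartAt I p p)
    (tangentDeriv I 𝓘(ℝ, E) (extChartAt I p) p v)
    (tangentDeriv I 𝓘(ℝ, E) (extChartAt I p) p w)

/-- The Laplacian of `h` with respect to `g`. -/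
def laplacian (g : BilinField I M) (h : M → ℝ) (p : M) : ℝ :=
  localLaplacian (coordField I g p) (h ∘ (extChartAt I p).symm) (extChartAt I p p)

/-- The function `|grad h|² = g(grad h, grad h)`. -/
def gradSq (g : BilinField I M) (h : M → ℝ) (p : M) : ℝ :=
  localGradSq (coordField I g p) (h ∘ (extChartAt I p).symm) (extChartAt I p p)

/-- The Einstein condition `Ric = μ g`. -/
def IsEinsteinWith (g : BilinField I M) (μ : ℝ) : Prop :=
  ∀ p v w, ricci I g p v w = μ * g p v w

/-- The condition `Ric = 0`. -/
def IsRicciFlat (g : BilinField I M) : Prop :=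
  ∀ p v w, ricci I g p v w = 0

/-- The metric `g_B ⊕ f² g_F = π_B^* g_B + (f ∘ π_B)² π_F^* g_F` of the warped product
`B ×_f F`. -/
def warpedMetric (I' : ModelWithCorners ℝ E' H')
    {F : Type*} [TopologicalSpace F] [ChartedSpace H' F]
    (gB : BilinField I M) (f : M → ℝ) (gF : BilinField I' F) :
    BilinField (I.prod I') (M × F) := fun p =>
  pullbackField (I.prod I') I Prod.fst gB p +
    (f p.1) ^ 2 • pullbackField (I.prod I') I' Prod.snd gF p

end Manifold

/-! ### Conformally pseudo-Euclidean strips and the implicit solutions -/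

/-- The function `ξ = ∑ α_i x_i` on `ℝ^n`. -/
def xi {n : ℕ} (α : Fin n → ℝ) (x : EuclideanSpace ℝ (Fin n)) : ℝ := ∑ i, α i * x i

/-- The open subset `{x | ξ(x) ∈ J}` of `ℝ^n`. -/
def strip {n : ℕ} (α : Fin n → ℝ) (J : Set ℝ) (hJ : IsOpen J) :
    TopologicalSpace.Opens (EuclideanSpace ℝ (Fin n)) :=
  ⟨{x | xi α x ∈ J}, hJ.preimage (by unfold xi; fun_prop)⟩

/-- The pseudo-Euclidean inner product `∑ ε_i u_i v_i`. -/
def pseudoEuclidean {n : ℕ} (ε : Fin n → ℝ) :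
    EuclideanSpace ℝ (Fin n) →L[ℝ] EuclideanSpace ℝ (Fin n) →L[ℝ] ℝ :=
  ∑ i, ε i • (ContinuousLinearMap.mul ℝ ℝ).bilinearComp
    (EuclideanSpace.proj i) (EuclideanSpace.proj i)

/-- The metric `φ(ξ)⁻² ∑ ε_i dx_i²` on the strip `{x | ξ(x) ∈ J}`. -/
def conformalMetric {n : ℕ} (ε α : Fin n → ℝ) (J : Set ℝ) (hJ : IsOpen J) (φ : ℝ → ℝ) :
    BilinField (𝓡 n) (strip α J hJ) :=
  pullbackField (𝓡 n) (𝓡 n) Subtype.val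
    (fun x : EuclideanSpace ℝ (Fin n) => (1 / φ (xi α x) ^ 2) • pseudoEuclidean ε)

/-- The metric `g_B = φ(ξ)⁻² ∑ ε_i dx_i² ⊕ f(ξ)² g_F` of the warped product `B = ℝ^n ×_f F`
over the strip `{x | ξ(x) ∈ J}`. -/
def baseMetric {n m : ℕ} (ε α : Fin n → ℝ) (J : Set ℝ) (hJ : IsOpen J) (φ f : ℝ → ℝ)
    {F : Type*} [TopologicalSpace F] [ChartedSpace (EuclideanSpace ℝ (Fin m)) F]
    (gF : BilinField (𝓡 m) F) : BilinField ((𝓡 n).prod (𝓡 m)) (strip α J hJ × F) :=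
  warpedMetric (𝓡 n) (𝓡 m) (conformalMetric ε α J hJ φ) (fun x => f (xi α x)) gF

/-- The function `h(ξ)` on `B = ℝ^n ×_f F`. -/
def baseFun {n : ℕ} (α : Fin n → ℝ) (J : Set ℝ) (hJ : IsOpen J) (h : ℝ → ℝ) {F : Type*} :
    strip α J hJ × F → ℝ := fun p => h (xi α p.1)

/-- The constant `a = (n - 2) k - m`. -/
def coefA (n m : ℕ) (k : ℝ) : ℝ := ((n : ℝ) - 2) * k - m

/-- The constant `b = m (2 k + 1) - (n - 2) k²`. -/
def coefB (n m : ℕ) (k : ℝ) : ℝ := (m : ℝ) * (2 * k + 1) - ((n : ℝ) - 2) * k ^ 2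

/-- The denominator `r (r - 1) z² - 2 r (k + a) z + a² - b` of `v(z)`. -/
def denomV (n m r : ℕ) (k z : ℝ) : ℝ :=
  (r : ℝ) * (r - 1) * z ^ 2 - 2 * r * (k + coefA n m k) * z + coefA n m k ^ 2 - coefB n m k

/-- The function `v(z) = r (a - r z) / (r (r - 1) z² - 2 r (k + a) z + a² - b)`. -/
def funV (n m r : ℕ) (k z : ℝ) : ℝ := r * (coefA n m k - r * z) / denomV n m r k z

/-- The functions `x(ξ)`, `z(ξ)` on the interval `J`, `z` nonconstant, satisfy
`v(z) z' - c (a - r z) e^{∫ v(z) dz} = 0` and `x = c e^{∫ v(z) dz}`,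
where `V` is the antiderivative `∫ v(z) dz` on the range of `z`. -/
structure IsImplicitPair (n m r : ℕ) (k c : ℝ) (J : Set ℝ) (V x z : ℝ → ℝ) : Prop where
  denom_ne_zero : ∀ s ∈ J, denomV n m r k (z s) ≠ 0
  antideriv : ∀ t ∈ z '' J, HasDerivAt V (funV n m r k t) t
  differentiable : ∀ s ∈ J, DifferentiableAt ℝ z s
  nonconstant : ∃ s ∈ J, ∃ t ∈ J, z s ≠ z t
  eq_z : ∀ s ∈ J,
    funV n m r k (z s) * deriv z s - c * (coefA n m k - r * z s) * Real.exp (V (z s)) = 0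
  eq_x : ∀ s ∈ J, x s = c * Real.exp (V (z s))

end

/-! For a warped product $A\oplus f^2C$ with fibre of dimension $m$ one has
$\mathrm{Ric}=\mathrm{Ric}_A-\frac mf\mathrm{Hess}_Af+\mathrm{Ric}_C-(f\Delta f+(m-1)|\nabla f|^2)C$
(`localRicci_warpedForm`). For the outer product over $B$, Ricci-flatness therefore follows from
$\mathrm{Ric}_B=\frac rh\mathrm{Hess}_Bh$ and from $h\Delta_Bh+(r-1)|\nabla h|^2$ being the Einstein
constant $\mu$ of $F_2$.

The same formula on $B$, with the Ricci tensor and Hessians of $\varphi^{-2}g$, turns the first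
equation into a comparison of the coefficients of $\xi\otimes\xi$, of $g$ and of $g_{F_1}$. Since
$\varphi'/\varphi=kx$ is proportional to $f'/f=x$, the last two comparisons both reduce to
$x'=x^2(a-rz)$. Given this, the first reduces to $z'=xD(z)/r$, with $D$ the denominator of $v$. The
second expression becomes $e\varphi^2h^2xz'=\frac er\varphi^2h^2x^2D(z)$ with $e=\varepsilon_{i_0}$,
a first integral of the system (`localHessian_warpedForm_conformalForm`, `exists_const`).

The delicate point is to derive this system from the implicit equation, which gives no information
on $z'$ where $a=rz$. As $z$ is only assumed differentiable, the Darboux property of derivatives and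
the nonconstancy of $z$ settle these points (`deriv_z_ne_zero`). What remains is the passage to
charts. -/

/-! ### Levi-Civita calculus on an open set of a vector space. -/

section LocalCalculus

open Filter Topology Set

variable {E : Type*} [NormedAddCommGroup E] [NormedSpace ℝ E]
  {F : Type*} [NormedAddCommGroup F] [NormedSpace ℝ F]

/-- `G` is a twice continuously differentiable metric on the open set `S`. -/
structure IsMetricOn (G : E → E →L[ℝ] E →L[ℝ] ℝ) (S : Set E) : Prop where
  isOpen : IsOpen S
  symm : ∀ y ∈ S, ∀ u v, G y u v = G y v u
  isInvertible : ∀ y ∈ S, (G y).IsInvertible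
  contDiffOn : ContDiffOn ℝ 2 G S

theorem koszul_apply (G : E → E →L[ℝ] E →L[ℝ] ℝ) (y u v w : E) :
    koszul G y u v w = fderiv ℝ G y u v w + fderiv ℝ G y v u w - fderiv ℝ G y w u v := by
  simp [koszul]

theorem christoffel_apply (G : E → E →L[ℝ] E →L[ℝ] ℝ) (y u v : E) :
    christoffel G y u v = (G y).inverse ((1 / 2 : ℝ) • koszul G y u v) := by
  simp [christoffel]

theorem curvatureEnd_apply (G : E → E →L[ℝ] E →L[ℝ] ℝ) (y v w u : E) :
    curvatureEnd G y v w u = fderiv ℝ (christoffel G) y u v w - fderiv ℝ (christoffel G) y v u w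
      + christoffel G y u (christoffel G y v w) - christoffel G y v (christoffel G y u w) := by
  simp [curvatureEnd]

theorem localHessian_apply (G : E → E →L[ℝ] E →L[ℝ] ℝ) (h : E → ℝ) (y u v : E) :
    localHessian G h y u v
      = fderiv ℝ (fderiv ℝ h) y u v - fderiv ℝ h y (christoffel G y u v) := by
  simp [localHessian]

theorem koszul_congr {G G' : E → E →L[ℝ] E →L[ℝ] ℝ} {y : E} (h : G =ᶠ[𝓝 y] G') :
    koszul G y = koszul G' y := by
  simp only [koszul, h.fderiv_eq]

theorem christoffel_congr {G G' : E → E →L[ℝ] E →L[ℝ] ℝ} {y : E} (h : G =ᶠ[𝓝 y] G') :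
    christoffel G y = christoffel G' y := by
  simp only [christoffel, koszul_congr h, h.eq_of_nhds]

theorem christoffel_eventuallyEq {G G' : E → E →L[ℝ] E →L[ℝ] ℝ} {y : E} (h : G =ᶠ[𝓝 y] G') :
    christoffel G =ᶠ[𝓝 y] christoffel G' := by
  filter_upwards [h.eventuallyEq_nhds] with y' hy' using christoffel_congr hy'

/-- Curvature depends only on the germ of the metric, so a chart expression may be replaced by an
explicit formula valid near the point. -/
theorem localRicci_congr {G G' : E → E →L[ℝ] E →L[ℝ] ℝ} {y : E} (h : G =ᶠ[𝓝 y] G') :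
    localRicci G y = localRicci G' y := by
  ext v w
  simp only [localRicci, curvatureEnd, christoffel_congr h, (christoffel_eventuallyEq h).fderiv_eq]

theorem localHessian_congr {G G' : E → E →L[ℝ] E →L[ℝ] ℝ} {f f' : E → ℝ} {y : E}
    (h : G =ᶠ[𝓝 y] G') (hf : f =ᶠ[𝓝 y] f') : localHessian G f y = localHessian G' f' y := by
  simp only [localHessian, christoffel_congr h, hf.fderiv.fderiv_eq, hf.fderiv_eq]

theorem localLaplacian_congr {G G' : E → E →L[ℝ] E →L[ℝ] ℝ} {f f' : E → ℝ} {y : E}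
    (h : G =ᶠ[𝓝 y] G') (hf : f =ᶠ[𝓝 y] f') : localLaplacian G f y = localLaplacian G' f' y := by
  simp only [localLaplacian, localHessian_congr h hf, h.eq_of_nhds]

theorem localGradSq_congr {G G' : E → E →L[ℝ] E →L[ℝ] ℝ} {f f' : E → ℝ} {y : E}
    (h : G =ᶠ[𝓝 y] G') (hf : f =ᶠ[𝓝 y] f') : localGradSq G f y = localGradSq G' f' y := by
  simp only [localGradSq, hf.fderiv_eq, h.eq_of_nhds]

/-- Evaluation at fixed vectors is linear and continuous. Tensor derivatives can thus be computed
with frozen arguments. -/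
theorem fderiv_apply_apply {H : Type*} [NormedAddCommGroup H] [NormedSpace ℝ H]
    {K : E → F →L[ℝ] F →L[ℝ] H} {y : E} (hK : DifferentiableAt ℝ K y)
    (u : E) (v w : F) : fderiv ℝ K y u v w = fderiv ℝ (fun y' => K y' v w) y u := by
  rw [((hK.hasFDerivAt.clm_apply (hasFDerivAt_const v y)).clm_apply
    (hasFDerivAt_const w y)).fderiv]
  simp

namespace IsMetricOn

variable {G : E → E →L[ℝ] E →L[ℝ] ℝ} {S : Set E} {y : E}

theorem contDiffAt (hG : IsMetricOn G S) (hy : y ∈ S) : ContDiffAt ℝ 2 G y :=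
  hG.contDiffOn.contDiffAt (hG.isOpen.mem_nhds hy)

theorem differentiableAt (hG : IsMetricOn G S) (hy : y ∈ S) : DifferentiableAt ℝ G y :=
  (hG.contDiffAt hy).differentiableAt (by norm_num)

theorem differentiableAt_inverse [CompleteSpace E] (hG : IsMetricOn G S) (hy : y ∈ S) :
    DifferentiableAt ℝ (fun y => (G y).inverse) y :=
  (((hG.isInvertible y hy).contDiffAt_map_inverse (n := 2)).comp y
    (hG.contDiffAt hy)).differentiableAt (by norm_num)

theorem differentiableAt_koszul (hG : IsMetricOn G S) (hy : y ∈ S) :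
    DifferentiableAt ℝ (koszul G) y := by
  have h1 : DifferentiableAt ℝ (fderiv ℝ G) y :=
    ((hG.contDiffAt hy).fderiv_right (m := 1) (by norm_num)).differentiableAt (by norm_num)
  have h2 : DifferentiableAt ℝ (fun y => (fderiv ℝ G y).flip) y :=
    (ContinuousLinearMap.flipₗᵢ ℝ E E (E →L[ℝ] ℝ)).differentiableAt.comp y h1
  exact (h1.add h2).sub ((differentiableAt_const _).clm_comp h2)

theorem differentiableAt_christoffel [CompleteSpace E] (hG : IsMetricOn G S) (hy : y ∈ S) :
    DifferentiableAt ℝ (christoffel G) y := by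
  refine DifferentiableAt.clm_comp ?_ ((hG.differentiableAt_koszul hy).fun_const_smul _)
  exact (ContinuousLinearMap.compL ℝ E (E →L[ℝ] ℝ) E).differentiableAt.comp y
    (hG.differentiableAt_inverse hy)

theorem apply_christoffel (hG : IsMetricOn G S) (hy : y ∈ S) (u v w : E) :
    G y (christoffel G y u v) w
      = (fderiv ℝ G y u v w + fderiv ℝ G y v u w - fderiv ℝ G y w u v) / 2 := by
  rw [christoffel_apply, (hG.isInvertible y hy).self_apply_inverse, ← koszul_apply]
  simp; ring

theorem eq_of_forall_apply (hG : IsMetricOn G S) (hy : y ∈ S) {u v : E}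
    (h : ∀ w, G y u w = G y v w) : u = v :=
  (hG.isInvertible y hy).injective (ContinuousLinearMap.ext h)

/-- Nondegeneracy makes the Koszul formula characterise the connection: a guessed Christoffel symbol
is checked by pairing with `w`, without inverting the metric. -/
theorem christoffel_eq (hG : IsMetricOn G S) (hy : y ∈ S) {u v a : E}
    (h : ∀ w, G y a w
      = (fderiv ℝ G y u v w + fderiv ℝ G y v u w - fderiv ℝ G y w u v) / 2) :
    christoffel G y u v = a :=
  hG.eq_of_forall_apply hy fun w => by rw [h, hG.apply_christoffel hy]

theorem fderiv_symm (hG : IsMetricOn G S) (hy : y ∈ S) (u v w : E) :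
    fderiv ℝ G y u v w = fderiv ℝ G y u w v := by
  rw [fderiv_apply_apply (hG.differentiableAt hy), fderiv_apply_apply (hG.differentiableAt hy)]
  have : (fun y' => G y' v w) =ᶠ[𝓝 y] fun y' => G y' w v := by
    filter_upwards [hG.isOpen.mem_nhds hy] with y' hy' using hG.symm y' hy' v w
  rw [this.fderiv_eq]

theorem christoffel_symm (hG : IsMetricOn G S) (hy : y ∈ S) (u v : E) :
    christoffel G y u v = christoffel G y v u :=
  hG.christoffel_eq hy fun w => by
    rw [hG.apply_christoffel hy, hG.fderiv_symm hy w u v]; ring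

/-- Metric compatibility, $\nabla G=0$. -/
theorem fderiv_eq (hG : IsMetricOn G S) (hy : y ∈ S) (u v w : E) :
    fderiv ℝ G y u v w = G y (christoffel G y u v) w + G y (christoffel G y u w) v := by
  rw [hG.apply_christoffel hy, hG.apply_christoffel hy, hG.fderiv_symm hy u w v,
    hG.fderiv_symm hy v u w, hG.fderiv_symm hy w u v]
  ring

end IsMetricOn

/-- The gradient of `f` with respect to `G`. -/
noncomputable def localGrad (G : E → E →L[ℝ] E →L[ℝ] ℝ) (f : E → ℝ) (y : E) : E :=
  (G y).inverse (fderiv ℝ f y)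

theorem localGradSq_eq (G : E → E →L[ℝ] E →L[ℝ] ℝ) (f : E → ℝ) (y : E) :
    localGradSq G f y = fderiv ℝ f y (localGrad G f y) := rfl

namespace IsMetricOn

variable {G : E → E →L[ℝ] E →L[ℝ] ℝ} {S : Set E} {y : E} {f : E → ℝ}

theorem apply_localGrad (hG : IsMetricOn G S) (hy : y ∈ S) (w : E) :
    G y (localGrad G f y) w = fderiv ℝ f y w := by
  rw [localGrad, (hG.isInvertible y hy).self_apply_inverse]

theorem apply_localGrad' (hG : IsMetricOn G S) (hy : y ∈ S) (w : E) :
    G y w (localGrad G f y) = fderiv ℝ f y w := by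
  rw [hG.symm y hy, hG.apply_localGrad hy]

theorem differentiableAt_localGrad [CompleteSpace E] (hG : IsMetricOn G S) (hy : y ∈ S)
    (hf : ContDiffAt ℝ 2 f y) : DifferentiableAt ℝ (localGrad G f) y :=
  (hG.differentiableAt_inverse hy).clm_apply
    ((hf.fderiv_right (m := 1) (by norm_num)).differentiableAt (by norm_num))

/-- Differentiating $df=G(\mathrm{grad} f,\cdot)$ and using $\nabla G=0$ shows that the Hessian with
an index raised is $\nabla\,\mathrm{grad} f$. This is the form in which it occurs in the curvature
of a warped product. -/
theorem inverse_localHessian_apply [CompleteSpace E] (hG : IsMetricOn G S) (hy : y ∈ S)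
    (hf : ContDiffAt ℝ 2 f y) (u : E) :
    (G y).inverse (localHessian G f y u)
      = fderiv ℝ (localGrad G f) y u + christoffel G y u (localGrad G f y) := by
  refine hG.eq_of_forall_apply hy fun w => ?_
  rw [(hG.isInvertible y hy).self_apply_inverse, localHessian_apply]
  have hN := hG.differentiableAt_localGrad hy hf
  have hf' : DifferentiableAt ℝ (fderiv ℝ f) y :=
    (hf.fderiv_right (m := 1) (by norm_num)).differentiableAt (by norm_num)
  have h1 : fderiv ℝ (fderiv ℝ f) y u w
      = G y (fderiv ℝ (localGrad G f) y u) w + fderiv ℝ G y u (localGrad G f y) w := by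
    have e : (fderiv ℝ f) =ᶠ[𝓝 y] fun y => G y (localGrad G f y) := by
      filter_upwards [hG.isOpen.mem_nhds hy] with y' hy'
      ext w; rw [hG.apply_localGrad hy']
    rw [e.fderiv_eq, ((hG.differentiableAt hy).hasFDerivAt.clm_apply hN.hasFDerivAt).fderiv]
    simp
  rw [h1, hG.fderiv_eq hy, hG.apply_localGrad' hy]
  simp; ring

theorem localLaplacian_eq [CompleteSpace E] (hG : IsMetricOn G S) (hy : y ∈ S)
    (hf : ContDiffAt ℝ 2 f y) :
    localLaplacian G f y = LinearMap.trace ℝ E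
      ((fderiv ℝ (localGrad G f) y + (christoffel G y).flip (localGrad G f y) : E →L[ℝ] E)
        : E →ₗ[ℝ] E) := by
  rw [localLaplacian]
  congr 2
  ext u
  simpa using hG.inverse_localHessian_apply hy hf u

end IsMetricOn

end LocalCalculus

/-! ### Warped products: inverse metric, connection, Hessian and gradient. -/

section LocalWarped

open Filter Topology Set

variable {E : Type*} [NormedAddCommGroup E] [NormedSpace ℝ E]
  {F : Type*} [NormedAddCommGroup F] [NormedSpace ℝ F]

/-- The metric `A ⊕ f² C` on a product of vector spaces. -/
noncomputable def warpedForm (A : E → E →L[ℝ] E →L[ℝ] ℝ) (f : E → ℝ)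
    (C : F → F →L[ℝ] F →L[ℝ] ℝ) (p : E × F) : E × F →L[ℝ] E × F →L[ℝ] ℝ :=
  (A p.1).bilinearComp (ContinuousLinearMap.fst ℝ E F) (ContinuousLinearMap.fst ℝ E F) +
    f p.1 ^ 2 • (C p.2).bilinearComp (ContinuousLinearMap.snd ℝ E F) (ContinuousLinearMap.snd ℝ E F)

variable {A : E → E →L[ℝ] E →L[ℝ] ℝ} {f : E → ℝ} {C : F → F →L[ℝ] F →L[ℝ] ℝ}
  {S : Set E} {T : Set F}

@[simp]
theorem warpedForm_apply (p X Y : E × F) :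
    warpedForm A f C p X Y = A p.1 X.1 Y.1 + f p.1 ^ 2 * C p.2 X.2 Y.2 := by
  simp [warpedForm]

theorem ContDiffOn.bilinearComp {H K : Type*} [NormedAddCommGroup H] [NormedSpace ℝ H]
    [NormedAddCommGroup K] [NormedSpace ℝ K]
    {B : H → E →L[ℝ] E →L[ℝ] ℝ} {s : Set H} {n : WithTop ℕ∞} (hB : ContDiffOn ℝ n B s)
    (L : K →L[ℝ] E) : ContDiffOn ℝ n (fun y => (B y).bilinearComp L L) s := by
  unfold ContinuousLinearMap.bilinearComp
  have h1 : ContDiffOn ℝ n (fun y => ((B y).comp L).flip) s :=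
    (ContinuousLinearMap.flipₗᵢ ℝ K E ℝ).contDiff.comp_contDiffOn (hB.clm_comp contDiffOn_const)
  exact (ContinuousLinearMap.flipₗᵢ ℝ K K ℝ).contDiff.comp_contDiffOn
    (h1.clm_comp contDiffOn_const)

theorem contDiffOn_warpedForm {n : WithTop ℕ∞} (hA : ContDiffOn ℝ n A S) (hf : ContDiffOn ℝ n f S)
    (hC : ContDiffOn ℝ n C T) : ContDiffOn ℝ n (warpedForm A f C) (S ×ˢ T) := by
  have h1 : ContDiffOn ℝ n (fun p : E × F => A p.1) (S ×ˢ T) :=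
    hA.comp contDiffOn_fst fun p hp => hp.1
  have h2 : ContDiffOn ℝ n (fun p : E × F => f p.1) (S ×ˢ T) :=
    hf.comp contDiffOn_fst fun p hp => hp.1
  have h3 : ContDiffOn ℝ n (fun p : E × F => C p.2) (S ×ˢ T) :=
    hC.comp contDiffOn_snd fun p hp => hp.2
  exact (h1.bilinearComp _).add ((h2.pow 2).smul (h3.bilinearComp _))

namespace IsMetricOn

/-- The metric is block diagonal, so each block is inverted separately. -/
theorem warpedForm_comp_inverse (hA : IsMetricOn A S) (hC : IsMetricOn C T) {p : E × F}
    (hp : p ∈ S ×ˢ T) (hf : f p.1 ≠ 0) :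
    (warpedForm A f C p).IsInvertible ∧ ∀ L, (warpedForm A f C p).inverse L =
      ((A p.1).inverse (L ∘L .inl ℝ E F), (f p.1 ^ 2)⁻¹ • (C p.2).inverse (L ∘L .inr ℝ E F)) := by
  let R : (E × F →L[ℝ] ℝ) →L[ℝ] E × F :=
    ((A p.1).inverse ∘L (ContinuousLinearMap.compL ℝ E (E × F) ℝ).flip (.inl ℝ E F)).prod
      ((f p.1 ^ 2)⁻¹ • ((C p.2).inverse ∘L
        (ContinuousLinearMap.compL ℝ F (E × F) ℝ).flip (.inr ℝ E F)))
  have hR : ∀ L, R L = ((A p.1).inverse (L ∘L .inl ℝ E F),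
    (f p.1 ^ 2)⁻¹ • (C p.2).inverse (L ∘L .inr ℝ E F)) := fun L => by simp [R]
  have h1 : warpedForm A f C p ∘L R = .id ℝ _ := by
    ext L X
    · simp [hR, (hA.isInvertible _ hp.1).self_apply_inverse]
    · simp [hR, (hC.isInvertible _ hp.2).self_apply_inverse, hf]
  have h2 : R ∘L warpedForm A f C p = .id ℝ _ := by
    have e1 : ∀ X, (warpedForm A f C p X) ∘L .inl ℝ E F = A p.1 X.1 := fun X => by ext; simp
    have e2 : ∀ X, (warpedForm A f C p X) ∘L .inr ℝ E F = f p.1 ^ 2 • C p.2 X.2 :=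
      fun X => by ext; simp
    refine ContinuousLinearMap.ext fun X => ?_
    simp only [ContinuousLinearMap.comp_apply, hR, e1, e2, map_smul,
      (hA.isInvertible _ hp.1).inverse_apply_self, (hC.isInvertible _ hp.2).inverse_apply_self]
    rw [smul_smul, inv_mul_cancel₀ (pow_ne_zero 2 hf), one_smul]
    rfl
  exact ⟨.of_inverse h1 h2, fun L => by rw [ContinuousLinearMap.inverse_eq h1 h2, hR]⟩

theorem warped (hA : IsMetricOn A S) (hC : IsMetricOn C T) (hf : ContDiffOn ℝ 2 f S)
    (hf0 : ∀ y ∈ S, f y ≠ 0) : IsMetricOn (warpedForm A f C) (S ×ˢ T) where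
  isOpen := hA.isOpen.prod hC.isOpen
  symm p hp X Y := by simp [hA.symm _ hp.1 X.1, hC.symm _ hp.2 X.2]
  isInvertible p hp := (hA.warpedForm_comp_inverse hC hp (hf0 _ hp.1)).1
  contDiffOn := contDiffOn_warpedForm hA.contDiffOn hf hC.contDiffOn

theorem fderiv_warpedForm (hA : IsMetricOn A S) (hC : IsMetricOn C T) (hf : ContDiffOn ℝ 2 f S)
    (hf0 : ∀ y ∈ S, f y ≠ 0) {p : E × F} (hp : p ∈ S ×ˢ T) (X Y Z : E × F) :
    fderiv ℝ (warpedForm A f C) p X Y Z = fderiv ℝ A p.1 X.1 Y.1 Z.1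
      + 2 * f p.1 * fderiv ℝ f p.1 X.1 * C p.2 Y.2 Z.2
      + f p.1 ^ 2 * fderiv ℝ C p.2 X.2 Y.2 Z.2 := by
  rw [fderiv_apply_apply ((hA.warped hC hf hf0).differentiableAt hp)]
  simp only [warpedForm_apply]
  have hfd : HasFDerivAt f (fderiv ℝ f p.1) p.1 :=
    ((hf.contDiffAt (hA.isOpen.mem_nhds hp.1)).differentiableAt (by norm_num)).hasFDerivAt
  have h1 := ((hA.differentiableAt hp.1).hasFDerivAt.comp p
    (hasFDerivAt_fst (𝕜 := ℝ))).clm_apply (hasFDerivAt_const Y.1 p)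
  have h2 := h1.clm_apply (hasFDerivAt_const Z.1 p)
  have h3 := ((hC.differentiableAt hp.2).hasFDerivAt.comp p
    (hasFDerivAt_snd (𝕜 := ℝ))).clm_apply (hasFDerivAt_const Y.2 p)
  have h4 := h3.clm_apply (hasFDerivAt_const Z.2 p)
  have h5 := (hfd.comp p (hasFDerivAt_fst (𝕜 := ℝ))).pow 2
  have := (h2.add (h5.mul h4)).fderiv
  simp only [Function.comp_def] at this
  refine (congrArg (fun L => L X) this).trans ?_
  simp
  ring

theorem christoffel_warpedForm (hA : IsMetricOn A S) (hC : IsMetricOn C T)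
    (hf : ContDiffOn ℝ 2 f S) (hf0 : ∀ y ∈ S, f y ≠ 0) {p : E × F} (hp : p ∈ S ×ˢ T)
    (X Y : E × F) :
    christoffel (warpedForm A f C) p X Y =
      (christoffel A p.1 X.1 Y.1 - (f p.1 * C p.2 X.2 Y.2) • localGrad A f p.1,
        christoffel C p.2 X.2 Y.2 + (fderiv ℝ f p.1 X.1 / f p.1) • Y.2
          + (fderiv ℝ f p.1 Y.1 / f p.1) • X.2) := by
  refine (hA.warped hC hf hf0).christoffel_eq hp fun Z => ?_
  simp only [fderiv_warpedForm hA hC hf hf0 hp, warpedForm_apply, map_sub, map_add, map_smul,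
    FunLike.coe_sub, FunLike.coe_add, Pi.sub_apply, Pi.add_apply, FunLike.coe_smul, Pi.smul_apply,
    smul_eq_mul, hA.apply_christoffel hp.1, hC.apply_christoffel hp.2, hA.apply_localGrad hp.1]
  have := hf0 _ hp.1
  rw [hC.symm _ hp.2 X.2 Z.2, hC.symm _ hp.2 Y.2 Z.2, hC.symm _ hp.2 X.2 Y.2]
  field_simp
  ring

end IsMetricOn

variable {h : E → ℝ}

theorem fderiv_comp_fst {p : E × F} (hh : DifferentiableAt ℝ h p.1) (X : E × F) :
    fderiv ℝ (fun q : E × F => h q.1) p X = fderiv ℝ h p.1 X.1 := by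
  have := (hh.hasFDerivAt.comp p (hasFDerivAt_fst (𝕜 := ℝ))).fderiv
  simp only [Function.comp_def] at this
  rw [this]; rfl

namespace IsMetricOn

/-- The fibre term comes from the component $-fC(Y,Z)\,\mathrm{grad} f$ of the connection: fibres
are not totally geodesic. -/
theorem localHessian_warpedForm (hA : IsMetricOn A S) (hC : IsMetricOn C T)
    (hf : ContDiffOn ℝ 2 f S) (hf0 : ∀ y ∈ S, f y ≠ 0) {p : E × F} (hp : p ∈ S ×ˢ T)
    (hh : ContDiffOn ℝ 2 h S) (Y Z : E × F) :
    localHessian (warpedForm A f C) (fun q => h q.1) p Y Z = localHessian A h p.1 Y.1 Z.1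
      + f p.1 * fderiv ℝ h p.1 (localGrad A f p.1) * C p.2 Y.2 Z.2 := by
  have hh2 : ContDiffAt ℝ 2 h p.1 := hh.contDiffAt (hA.isOpen.mem_nhds hp.1)
  have hd : ∀ q ∈ S ×ˢ T, DifferentiableAt ℝ h q.1 := fun q hq =>
    (hh.contDiffAt (hA.isOpen.mem_nhds hq.1)).differentiableAt (by norm_num)
  have e : fderiv ℝ (fun q : E × F => h q.1) =ᶠ[𝓝 p]
      fun q => (fderiv ℝ h q.1) ∘L .fst ℝ E F := by
    filter_upwards [(hA.isOpen.prod hC.isOpen).mem_nhds hp] with q hq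
    ext X <;> simp [fderiv_comp_fst (hd q hq)]
  have hdd : HasFDerivAt (fderiv ℝ h) (fderiv ℝ (fderiv ℝ h) p.1) p.1 :=
    ((hh2.fderiv_right (m := 1) (by norm_num)).differentiableAt (by norm_num)).hasFDerivAt
  have := ((hdd.comp p (hasFDerivAt_fst (𝕜 := ℝ))).clm_comp
    (hasFDerivAt_const (ContinuousLinearMap.fst ℝ E F) p)).fderiv
  simp only [Function.comp_def] at this
  rw [localHessian_apply, localHessian_apply, fderiv_comp_fst (hd p hp), e.fderiv_eq, this,
    hA.christoffel_warpedForm hC hf hf0 hp]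
  simp
  ring

theorem localGradSq_warpedForm (hA : IsMetricOn A S) (hC : IsMetricOn C T)
    (hf0 : ∀ y ∈ S, f y ≠ 0) {p : E × F} (hp : p ∈ S ×ˢ T)
    (hh : DifferentiableAt ℝ h p.1) :
    localGradSq (warpedForm A f C) (fun q => h q.1) p = localGradSq A h p.1 := by
  have e : fderiv ℝ (fun q : E × F => h q.1) p ∘L .inl ℝ E F = fderiv ℝ h p.1 := by
    ext u; simp [fderiv_comp_fst hh]
  rw [localGradSq, fderiv_comp_fst hh, (hA.warpedForm_comp_inverse hC hp (hf0 _ hp.1)).2, e]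
  rfl

end IsMetricOn

end LocalWarped

/-! ### Ricci tensor and Laplacian of a warped product. -/

section LocalWarpedCurvature

open Filter Topology Set Module

variable {E : Type*} [NormedAddCommGroup E] [NormedSpace ℝ E] [FiniteDimensional ℝ E]
  {F : Type*} [NormedAddCommGroup F] [NormedSpace ℝ F] [FiniteDimensional ℝ F]

/-- Only the diagonal blocks contribute to a trace, by cyclicity. Hence the mixed components of the
curvature endomorphism never have to be computed. -/
theorem trace_prod_eq (L : E × F →L[ℝ] E × F) :
    LinearMap.trace ℝ (E × F) (L : E × F →ₗ[ℝ] E × F)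
      = LinearMap.trace ℝ E
          ((.fst ℝ E F ∘L L ∘L .inl ℝ E F : E →L[ℝ] E) : E →ₗ[ℝ] E)
        + LinearMap.trace ℝ F
          ((.snd ℝ E F ∘L L ∘L .inr ℝ E F : F →L[ℝ] F) : F →ₗ[ℝ] F) := by
  have h1 := LinearMap.trace_comp_comm' ((L : E × F →ₗ[ℝ] E × F) ∘ₗ LinearMap.inl ℝ E F)
    (LinearMap.fst ℝ E F)
  have h2 := LinearMap.trace_comp_comm' ((L : E × F →ₗ[ℝ] E × F) ∘ₗ LinearMap.inr ℝ E F)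
    (LinearMap.snd ℝ E F)
  have e : (L : E × F →ₗ[ℝ] E × F)
      = ((L : E × F →ₗ[ℝ] E × F) ∘ₗ LinearMap.inl ℝ E F) ∘ₗ LinearMap.fst ℝ E F
        + ((L : E × F →ₗ[ℝ] E × F) ∘ₗ LinearMap.inr ℝ E F) ∘ₗ LinearMap.snd ℝ E F := by
    have h0 : L (0, 0) = 0 := map_zero L
    ext <;> simp [h0]
  conv_lhs => rw [e, map_add, ← h1, ← h2]
  rfl

variable {A : E → E →L[ℝ] E →L[ℝ] ℝ} {f : E → ℝ} {C : F → F →L[ℝ] F →L[ℝ] ℝ}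
  {S : Set E} {T : Set F}

namespace IsMetricOn

theorem fderiv_christoffel_warpedForm (hA : IsMetricOn A S) (hC : IsMetricOn C T)
    (hf : ContDiffOn ℝ 2 f S) (hf0 : ∀ y ∈ S, f y ≠ 0) {p : E × F} (hp : p ∈ S ×ˢ T)
    (X Y Z : E × F) :
    fderiv ℝ (christoffel (warpedForm A f C)) p X Y Z =
      (fderiv ℝ (christoffel A) p.1 X.1 Y.1 Z.1
        - (fderiv ℝ f p.1 X.1 * C p.2 Y.2 Z.2 + f p.1 * fderiv ℝ C p.2 X.2 Y.2 Z.2) •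
            localGrad A f p.1
        - (f p.1 * C p.2 Y.2 Z.2) • fderiv ℝ (localGrad A f) p.1 X.1,
      fderiv ℝ (christoffel C) p.2 X.2 Y.2 Z.2
        + (fderiv ℝ (fderiv ℝ f) p.1 X.1 Y.1 / f p.1
            - fderiv ℝ f p.1 X.1 * fderiv ℝ f p.1 Y.1 / f p.1 ^ 2) • Z.2
        + (fderiv ℝ (fderiv ℝ f) p.1 X.1 Z.1 / f p.1
            - fderiv ℝ f p.1 X.1 * fderiv ℝ f p.1 Z.1 / f p.1 ^ 2) • Y.2) := by
  have hW := hA.warped hC hf hf0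
  rw [fderiv_apply_apply (hW.differentiableAt_christoffel hp)]
  have e : (fun p => christoffel (warpedForm A f C) p Y Z) =ᶠ[𝓝 p] fun p =>
      (christoffel A p.1 Y.1 Z.1 - (f p.1 * C p.2 Y.2 Z.2) • localGrad A f p.1,
        christoffel C p.2 Y.2 Z.2 + (fderiv ℝ f p.1 Y.1 / f p.1) • Z.2
          + (fderiv ℝ f p.1 Z.1 / f p.1) • Y.2) := by
    filter_upwards [hW.isOpen.mem_nhds hp] with q hq
      using hA.christoffel_warpedForm hC hf hf0 hq Y Z
  rw [e.fderiv_eq]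
  have hf2 : ContDiffAt ℝ 2 f p.1 := hf.contDiffAt (hA.isOpen.mem_nhds hp.1)
  have hfd : HasFDerivAt f (fderiv ℝ f p.1) p.1 :=
    (hf2.differentiableAt (by norm_num)).hasFDerivAt
  have hfdd : HasFDerivAt (fderiv ℝ f) (fderiv ℝ (fderiv ℝ f) p.1) p.1 :=
    ((hf2.fderiv_right (m := 1) (by norm_num)).differentiableAt (by norm_num)).hasFDerivAt
  have h0 := hf0 _ hp.1
  have hF := hfd.comp p (hasFDerivAt_fst (𝕜 := ℝ))
  have hDF := fun u : E => (hfdd.comp p (hasFDerivAt_fst (𝕜 := ℝ))).clm_apply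
    (hasFDerivAt_const u p)
  have hN := (hA.differentiableAt_localGrad hp.1 hf2).hasFDerivAt.comp p
    (hasFDerivAt_fst (𝕜 := ℝ))
  have hGA := (((hA.differentiableAt_christoffel hp.1).hasFDerivAt.comp p
    (hasFDerivAt_fst (𝕜 := ℝ))).clm_apply (hasFDerivAt_const Y.1 p)).clm_apply
    (hasFDerivAt_const Z.1 p)
  have hGC := (((hC.differentiableAt_christoffel hp.2).hasFDerivAt.comp p
    (hasFDerivAt_snd (𝕜 := ℝ))).clm_apply (hasFDerivAt_const Y.2 p)).clm_apply
    (hasFDerivAt_const Z.2 p)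
  have hCC := (((hC.differentiableAt hp.2).hasFDerivAt.comp p
    (hasFDerivAt_snd (𝕜 := ℝ))).clm_apply (hasFDerivAt_const Y.2 p)).clm_apply
    (hasFDerivAt_const Z.2 p)
  have hinv : HasFDerivAt (fun p : E × F => (f p.1)⁻¹) _ p :=
    (hasDerivAt_inv (x := f p.1) h0).comp_hasFDerivAt p hF
  have hq := fun u : E => (hDF u).mul hinv
  have := ((hGA.sub ((hF.mul hCC).smul hN)).prodMk
    ((hGC.add ((hq Y.1).smul_const Z.2)).add ((hq Z.1).smul_const Y.2))).fderiv
  simp only [Function.comp_def] at this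
  simp only [div_eq_mul_inv]
  refine (congrArg (fun L => L X) this).trans ?_
  ext1
  · simp
    module
  · simp
    module

/-- Diagonal block on the base. Its last term is $\nabla\,\mathrm{grad} f$, whose trace is the
Laplacian. -/
theorem curvatureEnd_warpedForm_inl (hA : IsMetricOn A S) (hC : IsMetricOn C T)
    (hf : ContDiffOn ℝ 2 f S) (hf0 : ∀ y ∈ S, f y ≠ 0) {p : E × F} (hp : p ∈ S ×ˢ T)
    (Y Z : E × F) (u : E) :
    (curvatureEnd (warpedForm A f C) p Y Z (u, 0)).1 = curvatureEnd A p.1 Y.1 Z.1 u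
      - (f p.1 * C p.2 Y.2 Z.2) •
        (fderiv ℝ (localGrad A f) p.1 u + christoffel A p.1 u (localGrad A f p.1)) := by
  have h0 := hf0 _ hp.1
  simp only [curvatureEnd_apply, hA.fderiv_christoffel_warpedForm hC hf hf0 hp,
    hA.christoffel_warpedForm hC hf hf0 hp]
  simp
  match_scalars <;> field_simp
  ring

theorem curvatureEnd_warpedForm_inr (hA : IsMetricOn A S) (hC : IsMetricOn C T)
    (hf : ContDiffOn ℝ 2 f S) (hf0 : ∀ y ∈ S, f y ≠ 0) {p : E × F} (hp : p ∈ S ×ˢ T)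
    (Y Z : E × F) (a : F) :
    (curvatureEnd (warpedForm A f C) p Y Z (0, a)).2 = curvatureEnd C p.2 Y.2 Z.2 a
      - (localHessian A f p.1 Y.1 Z.1 / f p.1 + localGradSq A f p.1 * C p.2 Y.2 Z.2) • a
      + (localGradSq A f p.1 * C p.2 Z.2 a) • Y.2 := by
  have h0 := hf0 _ hp.1
  simp only [curvatureEnd_apply, hA.fderiv_christoffel_warpedForm hC hf hf0 hp,
    hA.christoffel_warpedForm hC hf hf0 hp, localGradSq_eq, localHessian_apply]
  simp [hC.christoffel_symm hp.2 Y.2 a, hC.symm _ hp.2 Z.2 a]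
  match_scalars <;> field_simp <;> ring

/-- The Ricci tensor of a warped product. -/
theorem localRicci_warpedForm (hA : IsMetricOn A S) (hC : IsMetricOn C T)
    (hf : ContDiffOn ℝ 2 f S) (hf0 : ∀ y ∈ S, f y ≠ 0) {p : E × F} (hp : p ∈ S ×ˢ T)
    (Y Z : E × F) :
    localRicci (warpedForm A f C) p Y Z = localRicci A p.1 Y.1 Z.1
      - finrank ℝ F / f p.1 * localHessian A f p.1 Y.1 Z.1 + localRicci C p.2 Y.2 Z.2
      - (f p.1 * localLaplacian A f p.1 + (finrank ℝ F - 1) * localGradSq A f p.1)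
        * C p.2 Y.2 Z.2 := by
  have hf2 : ContDiffAt ℝ 2 f p.1 := hf.contDiffAt (hA.isOpen.mem_nhds hp.1)
  have e1 : ((.fst ℝ E F ∘L curvatureEnd (warpedForm A f C) p Y Z ∘L .inl ℝ E F : E →L[ℝ] E)
      : E →ₗ[ℝ] E) = (curvatureEnd A p.1 Y.1 Z.1 : E →ₗ[ℝ] E) - (f p.1 * C p.2 Y.2 Z.2) •
        ((fderiv ℝ (localGrad A f) p.1 + (christoffel A p.1).flip (localGrad A f p.1)
          : E →L[ℝ] E) : E →ₗ[ℝ] E) := by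
    ext u
    simpa using hA.curvatureEnd_warpedForm_inl hC hf hf0 hp Y Z u
  -- The multiple of the identity has trace proportional to $\dim F$; the rank-one term gives back
  -- one copy of $|\nabla f|^2C(Y,Z)$, whence the factor $\dim F-1$.
  have e2 : ((.snd ℝ E F ∘L curvatureEnd (warpedForm A f C) p Y Z ∘L .inr ℝ E F : F →L[ℝ] F)
      : F →ₗ[ℝ] F) = (curvatureEnd C p.2 Y.2 Z.2 : F →ₗ[ℝ] F)
      - (localHessian A f p.1 Y.1 Z.1 / f p.1 + localGradSq A f p.1 * C p.2 Y.2 Z.2) •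
        LinearMap.id
      + localGradSq A f p.1 • ((C p.2 Z.2 : F →ₗ[ℝ] ℝ).smulRight Y.2) := by
    ext a
    simpa [smul_smul] using hA.curvatureEnd_warpedForm_inr hC hf hf0 hp Y Z a
  rw [localRicci, trace_prod_eq, e1, e2, hA.localLaplacian_eq hp.1 hf2]
  simp only [map_sub, map_add, map_smul, LinearMap.trace_id, LinearMap.trace_smulRight,
    localRicci, smul_eq_mul]
  simp [hC.symm _ hp.2 Z.2 Y.2]
  ring

variable {h : E → ℝ}

theorem localLaplacian_warpedForm (hA : IsMetricOn A S) (hC : IsMetricOn C T)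
    (hf : ContDiffOn ℝ 2 f S) (hf0 : ∀ y ∈ S, f y ≠ 0) {p : E × F} (hp : p ∈ S ×ˢ T)
    (hh : ContDiffOn ℝ 2 h S) :
    localLaplacian (warpedForm A f C) (fun q => h q.1) p = localLaplacian A h p.1
      + finrank ℝ F / f p.1 * fderiv ℝ h p.1 (localGrad A f p.1) := by
  have h0 := hf0 _ hp.1
  have e1 : ((.fst ℝ E F ∘L ((warpedForm A f C p).inverse ∘L
      localHessian (warpedForm A f C) (fun q => h q.1) p) ∘L .inl ℝ E F : E →L[ℝ] E) : E →ₗ[ℝ] E)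
      = ((A p.1).inverse ∘L localHessian A h p.1 : E →L[ℝ] E) := by
    ext u
    simp [(hA.warpedForm_comp_inverse hC hp h0).2]
    congr 1
    ext v
    simp [hA.localHessian_warpedForm hC hf hf0 hp hh]
  have e2 : ((.snd ℝ E F ∘L ((warpedForm A f C p).inverse ∘L
      localHessian (warpedForm A f C) (fun q => h q.1) p) ∘L .inr ℝ E F : F →L[ℝ] F) : F →ₗ[ℝ] F)
      = (fderiv ℝ h p.1 (localGrad A f p.1) / f p.1) • LinearMap.id := by
    ext a
    have : localHessian (warpedForm A f C) (fun q => h q.1) p (0, a) ∘L .inr ℝ E F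
        = (f p.1 * fderiv ℝ h p.1 (localGrad A f p.1)) • C p.2 a := by
      ext b
      simp [hA.localHessian_warpedForm hC hf hf0 hp hh]
    simp [(hA.warpedForm_comp_inverse hC hp h0).2, this,
      (hC.isInvertible _ hp.2).inverse_apply_self, smul_smul]
    congr 1
    field_simp
  rw [localLaplacian, trace_prod_eq, e1, e2, localLaplacian]
  simp
  ring

end IsMetricOn

end LocalWarpedCurvature

/-! ### Conformally flat metrics depending on one linear coordinate. -/

section LocalConformal

open Filter Topology Set Module

variable {E : Type*} [NormedAddCommGroup E] [NormedSpace ℝ E]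

/-- The conformally flat metric `φ(ξ)⁻² η`, where `ξ` is a covector. -/
noncomputable def conformalForm (η : E →L[ℝ] E →L[ℝ] ℝ) (ξ : E →L[ℝ] ℝ) (φ : ℝ → ℝ) (y : E) :
    E →L[ℝ] E →L[ℝ] ℝ := (1 / φ (ξ y) ^ 2) • η

variable {η : E →L[ℝ] E →L[ℝ] ℝ} {ξ : E →L[ℝ] ℝ} {φ κ : ℝ → ℝ} {J : Set ℝ} {ν : E} {e : ℝ}

theorem contDiffOn_comp_covector {F : ℝ → ℝ} {n : WithTop ℕ∞} (hF : ContDiffOn ℝ n F J) :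
    ContDiffOn ℝ n (fun y => F (ξ y)) (ξ ⁻¹' J) :=
  hF.comp ξ.contDiff.contDiffOn fun _ h => h

theorem contDiffOn_conformalForm {n : WithTop ℕ∞} (hφ : ContDiffOn ℝ n φ J)
    (hφ0 : ∀ s ∈ J, φ s ≠ 0) : ContDiffOn ℝ n (conformalForm η ξ φ) (ξ ⁻¹' J) := by
  have h1 := contDiffOn_comp_covector (ξ := ξ) hφ
  exact (contDiffOn_const.div (h1.pow 2) fun y hy => pow_ne_zero 2 (hφ0 _ hy)).smul
    contDiffOn_const

theorem isMetricOn_conformalForm (hη : ∀ u v, η u v = η v u) (hη' : η.IsInvertible)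
    (hJ : IsOpen J) (hφ : ContDiffOn ℝ 2 φ J) (hφ0 : ∀ s ∈ J, φ s ≠ 0) :
    IsMetricOn (conformalForm η ξ φ) (ξ ⁻¹' J) where
  isOpen := hJ.preimage ξ.continuous
  symm y _ u v := by simp [conformalForm, hη u v]
  isInvertible y hy := by
    have h0 := hφ0 _ hy
    refine .of_inverse (g := φ (ξ y) ^ 2 • η.inverse) ?_ ?_
    · ext L v; simp [conformalForm, hη'.self_apply_inverse, h0]
    · ext v; simp [conformalForm, hη'.inverse_apply_self, h0, smul_smul]
  contDiffOn := contDiffOn_conformalForm hφ hφ0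

theorem inverse_conformalForm_apply (hη' : η.IsInvertible) {y : E} (h0 : φ (ξ y) ≠ 0)
    (L : E →L[ℝ] ℝ) : (conformalForm η ξ φ y).inverse L = φ (ξ y) ^ 2 • η.inverse L := by
  have : (conformalForm η ξ φ y).inverse = φ (ξ y) ^ 2 • η.inverse := by
    refine ContinuousLinearMap.inverse_eq ?_ ?_
    · ext L v; simp [conformalForm, hη'.self_apply_inverse, h0]
    · ext v; simp [conformalForm, hη'.inverse_apply_self, h0, smul_smul]
  rw [this]; rfl

theorem fderiv_comp_covector {F : ℝ → ℝ} {F' : ℝ} {y : E} (hF : HasDerivAt F F' (ξ y)) :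
    fderiv ℝ (fun y => F (ξ y)) y = F' • ξ :=
  (hF.comp_hasFDerivAt y ξ.hasFDerivAt).fderiv

theorem fderiv_conformalForm {y : E} (hφ0 : φ (ξ y) ≠ 0)
    (hφ : HasDerivAt φ (φ (ξ y) * κ (ξ y)) (ξ y)) (u v w : E) :
    fderiv ℝ (conformalForm η ξ φ) y u v w
      = -2 * κ (ξ y) / φ (ξ y) ^ 2 * ξ u * η v w := by
  have h1 : HasDerivAt (fun s => 1 / φ s ^ 2) (-2 * κ (ξ y) / φ (ξ y) ^ 2) (ξ y) := by
    refine ((hasDerivAt_const (ξ y) (1 : ℝ)).div (hφ.pow 2) (pow_ne_zero 2 hφ0)).congr_deriv ?_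
    simp
    field_simp
  have h2 := ((h1.comp_hasFDerivAt y ξ.hasFDerivAt).smul_const η).fderiv
  simp only [Function.comp_def] at h2
  unfold conformalForm
  rw [h2]
  simp

/-- Here `κ` is the logarithmic derivative of `φ`, and `ν` is the vector dual to `ξ` under `η`. This
is the conformal change of the flat connection. -/
theorem christoffel_conformalForm (hη : ∀ u v, η u v = η v u) (hη' : η.IsInvertible)
    (hJ : IsOpen J) (hφ : ContDiffOn ℝ 2 φ J) (hφ0 : ∀ s ∈ J, φ s ≠ 0)
    (hφ' : ∀ s ∈ J, HasDerivAt φ (φ s * κ s) s) (hν : ∀ w, η ν w = ξ w) {y : E} (hy : ξ y ∈ J)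
    (u v : E) :
    christoffel (conformalForm η ξ φ) y u v
      = -κ (ξ y) • (ξ u • v + ξ v • u - η u v • ν) := by
  have hG := isMetricOn_conformalForm (ξ := ξ) hη hη' hJ hφ hφ0
  refine hG.christoffel_eq hy fun w => ?_
  simp only [fderiv_conformalForm (hφ0 _ hy) (hφ' _ hy)]
  have h0 := hφ0 _ hy
  simp [conformalForm, hν]
  rw [hη u w, hη v w]
  field_simp
  ring

theorem fderiv_christoffel_conformalForm [CompleteSpace E]
    (hη : ∀ u v, η u v = η v u) (hη' : η.IsInvertible)
    (hJ : IsOpen J) (hφ : ContDiffOn ℝ 2 φ J) (hφ0 : ∀ s ∈ J, φ s ≠ 0)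
    (hφ' : ∀ s ∈ J, HasDerivAt φ (φ s * κ s) s) (hν : ∀ w, η ν w = ξ w) {y : E} (hy : ξ y ∈ J)
    {κ' : ℝ} (hκ : HasDerivAt κ κ' (ξ y)) (u v w : E) :
    fderiv ℝ (christoffel (conformalForm η ξ φ)) y u v w
      = (-κ' * ξ u) • (ξ v • w + ξ w • v - η v w • ν) := by
  have hG := isMetricOn_conformalForm (ξ := ξ) hη hη' hJ hφ hφ0
  rw [fderiv_apply_apply (hG.differentiableAt_christoffel hy)]
  have ev : (fun y => christoffel (conformalForm η ξ φ) y v w) =ᶠ[𝓝 y]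
      fun y => -κ (ξ y) • (ξ v • w + ξ w • v - η v w • ν) := by
    filter_upwards [hG.isOpen.mem_nhds hy] with y' hy'
      using christoffel_conformalForm hη hη' hJ hφ hφ0 hφ' hν hy' v w
  have h2 := ((hκ.comp_hasFDerivAt y ξ.hasFDerivAt).neg.smul_const
    (ξ v • w + ξ w • v - η v w • ν)).fderiv
  simp only [Function.comp_def, Pi.neg_def] at h2
  rw [ev.fderiv_eq, h2]
  simp

theorem localGrad_conformalForm (hη' : η.IsInvertible) (hν : ∀ w, η ν w = ξ w) {y : E}
    (h0 : φ (ξ y) ≠ 0) {F : ℝ → ℝ} {F' : ℝ} (hF : HasDerivAt F F' (ξ y)) :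
    localGrad (conformalForm η ξ φ) (fun y => F (ξ y)) y = (φ (ξ y) ^ 2 * F') • ν := by
  have e1 : η.inverse ξ = ν := by
    rw [hη'.inverse_apply_eq]; ext w; rw [hν]
  rw [localGrad, inverse_conformalForm_apply hη' h0, fderiv_comp_covector hF, map_smul, e1,
    smul_smul]

theorem localHessian_conformalForm (hη : ∀ u v, η u v = η v u) (hη' : η.IsInvertible)
    (hJ : IsOpen J) (hφ : ContDiffOn ℝ 2 φ J) (hφ0 : ∀ s ∈ J, φ s ≠ 0)
    (hφ' : ∀ s ∈ J, HasDerivAt φ (φ s * κ s) s) (hν : ∀ w, η ν w = ξ w) (he : ξ ν = e)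
    {y : E} (hy : ξ y ∈ J) {F F' : ℝ → ℝ} {F'' : ℝ} (hF : ∀ s ∈ J, HasDerivAt F (F' s) s)
    (hF' : HasDerivAt F' F'' (ξ y)) (u v : E) :
    localHessian (conformalForm η ξ φ) (fun y => F (ξ y)) y u v
      = (F'' + 2 * κ (ξ y) * F' (ξ y)) * (ξ u * ξ v) - κ (ξ y) * F' (ξ y) * e * η u v := by
  have ev : fderiv ℝ (fun y => F (ξ y)) =ᶠ[𝓝 y] fun y => F' (ξ y) • ξ := by
    filter_upwards [(hJ.preimage ξ.continuous).mem_nhds hy] with y' hy'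
      using fderiv_comp_covector (hF _ hy')
  have h2 := ((hF'.comp_hasFDerivAt y ξ.hasFDerivAt).smul_const ξ).fderiv
  simp only [Function.comp_def] at h2
  rw [localHessian_apply, ev.fderiv_eq, h2, fderiv_comp_covector (hF _ hy),
    christoffel_conformalForm hη hη' hJ hφ hφ0 hφ' hν hy]
  simp [he]
  ring

variable [FiniteDimensional ℝ E]

theorem localLaplacian_conformalForm (hη : ∀ u v, η u v = η v u) (hη' : η.IsInvertible)
    (hJ : IsOpen J) (hφ : ContDiffOn ℝ 2 φ J) (hφ0 : ∀ s ∈ J, φ s ≠ 0)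
    (hφ' : ∀ s ∈ J, HasDerivAt φ (φ s * κ s) s) (hν : ∀ w, η ν w = ξ w) (he : ξ ν = e)
    {y : E} (hy : ξ y ∈ J) {F F' : ℝ → ℝ} {F'' : ℝ} (hF : ∀ s ∈ J, HasDerivAt F (F' s) s)
    (hF' : HasDerivAt F' F'' (ξ y)) :
    localLaplacian (conformalForm η ξ φ) (fun y => F (ξ y)) y
      = φ (ξ y) ^ 2 * e * (F'' - (finrank ℝ E - 2) * κ (ξ y) * F' (ξ y)) := by
  have e1 : η.inverse ξ = ν := by
    rw [hη'.inverse_apply_eq]; ext w; rw [hν]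
  have e2 : (((conformalForm η ξ φ y).inverse ∘L
        localHessian (conformalForm η ξ φ) (fun y => F (ξ y)) y : E →L[ℝ] E) : E →ₗ[ℝ] E)
      = φ (ξ y) ^ 2 • ((F'' + 2 * κ (ξ y) * F' (ξ y)) • (ξ : E →ₗ[ℝ] ℝ).smulRight ν
          - (κ (ξ y) * F' (ξ y) * e) • LinearMap.id) := by
    ext u
    have : localHessian (conformalForm η ξ φ) (fun y => F (ξ y)) y u
        = (F'' + 2 * κ (ξ y) * F' (ξ y)) • ξ u • ξ - (κ (ξ y) * F' (ξ y) * e) • η u := by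
      ext v
      rw [localHessian_conformalForm hη hη' hJ hφ hφ0 hφ' hν he hy hF hF']
      simp
    simp [inverse_conformalForm_apply hη' (hφ0 _ hy), this, hη'.inverse_apply_self, e1]
  rw [localLaplacian, e2]
  simp [he]
  ring

/-- The curvature endomorphism is a combination of the identity and rank-one maps. Its trace is read
off from $\mathrm{tr}(\mathrm{id})=\dim E$ and $\mathrm{tr}(L\otimes v)=L(v)$. -/
theorem localRicci_conformalForm (hη : ∀ u v, η u v = η v u) (hη' : η.IsInvertible)
    (hJ : IsOpen J) (hφ : ContDiffOn ℝ 2 φ J) (hφ0 : ∀ s ∈ J, φ s ≠ 0)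
    (hφ' : ∀ s ∈ J, HasDerivAt φ (φ s * κ s) s) (hν : ∀ w, η ν w = ξ w) (he : ξ ν = e)
    {y : E} (hy : ξ y ∈ J) {κ' : ℝ} (hκ : HasDerivAt κ κ' (ξ y)) (v w : E) :
    localRicci (conformalForm η ξ φ) y v w
      = (finrank ℝ E - 2) * (κ' + κ (ξ y) ^ 2) * (ξ v * ξ w)
        + e * (κ' - (finrank ℝ E - 2) * κ (ξ y) ^ 2) * η v w := by
  set k := κ (ξ y)
  have e1 : (curvatureEnd (conformalForm η ξ φ) y v w : E →ₗ[ℝ] E)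
      = (-κ') • ((ξ : E →ₗ[ℝ] ℝ).smulRight (ξ v • w + ξ w • v - η v w • ν))
        + (κ' * ξ v) • ((ξ : E →ₗ[ℝ] ℝ).smulRight w + ξ w • LinearMap.id
          - (η w : E →ₗ[ℝ] ℝ).smulRight ν)
        + k ^ 2 • ((ξ : E →ₗ[ℝ] ℝ).smulRight (ξ v • w + ξ w • v - η v w • ν)
          + ξ (ξ v • w + ξ w • v - η v w • ν) • LinearMap.id
          - (η (ξ v • w + ξ w • v - η v w • ν) : E →ₗ[ℝ] ℝ).smulRight ν)
        - k ^ 2 • (ξ v • ((ξ : E →ₗ[ℝ] ℝ).smulRight w + ξ w • LinearMap.id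
            - (η w : E →ₗ[ℝ] ℝ).smulRight ν)
          + (ξ : E →ₗ[ℝ] ℝ).smulRight (ξ w • v) + ξ w • (ξ : E →ₗ[ℝ] ℝ).smulRight v
          - (η w : E →ₗ[ℝ] ℝ).smulRight (ξ ν • v)
          - (ξ : E →ₗ[ℝ] ℝ).smulRight (η v w • ν) - ξ w • (η v : E →ₗ[ℝ] ℝ).smulRight ν
          + (η w : E →ₗ[ℝ] ℝ).smulRight (η v ν • ν)) := by
    ext u
    simp only [ContinuousLinearMap.coe_coe, curvatureEnd_apply,
      fderiv_christoffel_conformalForm hη hη' hJ hφ hφ0 hφ' hν hy hκ,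
      christoffel_conformalForm hη hη' hJ hφ hφ0 hφ' hν hy]
    simp [hη u, hη v ν, hν, he]
    module
  rw [localRicci, e1]
  simp only [map_sub, map_add, map_smul, LinearMap.trace_id, LinearMap.trace_smulRight,
    smul_eq_mul, ContinuousLinearMap.coe_coe]
  simp [he, hη v ν, hη w ν, hν, hη w v]
  ring

end LocalConformal

/-! ### From the implicit equation to a first-order system and its first integral. -/

section ImplicitPair

open Filter Topology Set

namespace IsImplicitPair

variable {n m r : ℕ} {k c : ℝ} {J : Set ℝ} {V x z : ℝ → ℝ}

theorem x_pos (hxz : IsImplicitPair n m r k c J V x z) (hc : 0 < c) {s : ℝ} (hs : s ∈ J) :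
    0 < x s := by
  rw [hxz.eq_x s hs]; positivity

/-- Since $x=ce^{V(z)}$, one has $x'=x\,v(z)z'$, and the implicit equation replaces $v(z)z'$ by
$x(a-rz)$. Nothing is divided by $a-rz$. -/
theorem hasDerivAt_x (hxz : IsImplicitPair n m r k c J V x z) (hJ : IsOpen J) {s : ℝ}
    (hs : s ∈ J) : HasDerivAt x (x s ^ 2 * (coefA n m k - r * z s)) s := by
  have h1 := ((hxz.antideriv (z s) (mem_image_of_mem z hs)).comp s
    (hxz.differentiable s hs).hasDerivAt).exp.const_mul c
  have e : x =ᶠ[𝓝 s] fun s => c * Real.exp ((V ∘ z) s) := by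
    filter_upwards [hJ.mem_nhds hs] with t ht using hxz.eq_x t ht
  refine (h1.congr_of_eventuallyEq e).congr_deriv ?_
  have := hxz.eq_z s hs
  rw [hxz.eq_x s hs, Function.comp_apply]
  linear_combination c * Real.exp (V (z s)) * this

theorem deriv_z_of_ne (hxz : IsImplicitPair n m r k c J V x z) (hr : 1 ≤ r) {s : ℝ}
    (hs : s ∈ J) (hne : coefA n m k - r * z s ≠ 0) :
    deriv z s = x s * denomV n m r k (z s) / r := by
  have h1 := hxz.eq_z s hs
  have hD := hxz.denom_ne_zero s hs
  have hr' : (r : ℝ) ≠ 0 := by positivity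
  rw [funV] at h1
  rw [hxz.eq_x s hs]
  field_simp at h1 ⊢
  refine mul_left_cancel₀ hne ?_
  linear_combination h1

theorem continuousAt_slope (hxz : IsImplicitPair n m r k c J V x z) (hJ : IsOpen J) {s : ℝ}
    (hs : s ∈ J) : ContinuousAt (fun s => x s * denomV n m r k (z s) / r) s := by
  have hz := (hxz.differentiable s hs).continuousAt
  have hx := (hxz.hasDerivAt_x hJ hs).continuousAt
  unfold denomV
  fun_prop

/-- Where $a=rz$ the implicit equation reads $0=0$. If $z'(s)\ne0$ at such a point, then $a-rz\ne0$
at nearby points, where $z'=xD(z)/r$; the limit of $z'$ from the right is then the right derivative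
at $s$. -/
theorem deriv_z_eq_zero_or (hxz : IsImplicitPair n m r k c J V x z) (hJ : IsOpen J) (hr : 1 ≤ r)
    {s : ℝ} (hs : s ∈ J) : deriv z s = 0 ∨ deriv z s = x s * denomV n m r k (z s) / r := by
  by_cases hne : coefA n m k - r * z s ≠ 0
  · exact .inr (hxz.deriv_z_of_ne hr hs hne)
  push Not at hne
  refine or_iff_not_imp_left.2 fun h0 => ?_
  have hd := (hxz.differentiable s hs).hasDerivAt
  have hr' : (r : ℝ) ≠ 0 := by positivity
  have h1 : ∀ᶠ t in 𝓝[>] s, deriv z t = x t * denomV n m r k (z t) / r := by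
    filter_upwards [(hd.eventually_ne h0 (c := z s)).filter_mono
      (nhdsWithin_mono s fun t (ht : s < t) => ht.ne'),
      mem_nhdsWithin_of_mem_nhds (hJ.mem_nhds hs)] with t ht htJ
    refine hxz.deriv_z_of_ne hr htJ fun h => ht ?_
    exact mul_left_cancel₀ hr' (by linarith)
  have h2 : Tendsto (deriv z) (𝓝[>] s) (𝓝 (x s * denomV n m r k (z s) / r)) :=
    ((hxz.continuousAt_slope hJ hs).tendsto.mono_left nhdsWithin_le_nhds).congr'
      (h1.mono fun _ h => h.symm)
  have h3 := hasDerivWithinAt_Ici_of_tendsto_deriv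
    (fun t ht => (hxz.differentiable t ht).differentiableWithinAt)
    hd.continuousAt.continuousWithinAt (mem_nhdsWithin_of_mem_nhds (hJ.mem_nhds hs)) h2
  exact (uniqueDiffWithinAt_Ici s).eq_deriv _ hd.hasDerivWithinAt h3

/-- On a compact interval $|xD(z)/r|$ has a positive lower bound $\delta$, so $z'$ is either $0$ or
of size at least $\delta$. By Darboux's theorem it cannot take both kinds of values, and
nonconstancy excludes $z'\equiv0$. -/
theorem deriv_z_ne_zero (hxz : IsImplicitPair n m r k c J V x z) (hJ : IsOpen J)
    (hJint : J.OrdConnected) (hr : 1 ≤ r) (hc : 0 < c) {s : ℝ} (hs : s ∈ J) : deriv z s ≠ 0 := by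
  intro h0
  obtain ⟨t, ht, ht0⟩ : ∃ t ∈ J, deriv z t ≠ 0 := by
    by_contra! hcon
    obtain ⟨s', hs', t', ht', hne⟩ := hxz.nonconstant
    exact hne (hJ.is_const_of_deriv_eq_zero hJint.isPreconnected
      (fun u hu => (hxz.differentiable u hu).differentiableWithinAt)
      (fun u hu => by simpa using hcon u hu) hs' ht')
  have hsub : uIcc s t ⊆ J := hJint.uIcc_subset hs ht
  have hr' : (r : ℝ) ≠ 0 := by positivity
  obtain ⟨u, hu, hmin⟩ := isCompact_uIcc.exists_isMinOn nonempty_uIcc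
    (f := fun s => |x s * denomV n m r k (z s) / r|) fun w hw =>
    ((hxz.continuousAt_slope hJ (hsub hw)).abs).continuousWithinAt
  set δ := |x u * denomV n m r k (z u) / r| with hδ
  have hδ0 : 0 < δ := abs_pos.2 (div_ne_zero (mul_ne_zero (hxz.x_pos hc (hsub hu)).ne'
    (hxz.denom_ne_zero u (hsub hu))) hr')
  have key : ∀ w ∈ uIcc s t, deriv z w = 0 ∨ δ ≤ |deriv z w| := fun w hw => by
    rcases hxz.deriv_z_eq_zero_or hJ hr (hsub hw) with h | h
    · exact .inl h
    · exact .inr (by rw [h]; exact hmin hw)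
  have hoc := (ordConnected_uIcc (a := s) (b := t)).image_deriv
    (f := z) fun w hw => hxz.differentiable w (hsub hw)
  have hm0 : (0 : ℝ) ∈ deriv z '' uIcc s t := ⟨s, left_mem_uIcc, h0⟩
  have hmt : deriv z t ∈ deriv z '' uIcc s t := mem_image_of_mem _ right_mem_uIcc
  have ht1 := (key t right_mem_uIcc).resolve_left ht0
  -- The intermediate value `δ / 2`, with the sign of `deriv z t`, lies in the forbidden gap.
  have : ∃ d ∈ deriv z '' uIcc s t, |d| = δ / 2 := by
    rcases le_total 0 (deriv z t) with hle | hle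
    · rw [abs_of_nonneg hle] at ht1
      exact ⟨δ / 2, hoc.out hm0 hmt ⟨by positivity, by linarith⟩, abs_of_pos (by positivity)⟩
    · rw [abs_of_nonpos hle] at ht1
      exact ⟨-(δ / 2), hoc.out hmt hm0 ⟨by linarith, by linarith⟩, by
        rw [abs_neg, abs_of_pos (by positivity)]⟩
  obtain ⟨_, ⟨w, hw, rfl⟩, hd⟩ := this
  rcases key w hw with h | h
  · rw [h, abs_zero] at hd; linarith
  · linarith

theorem hasDerivAt_z (hxz : IsImplicitPair n m r k c J V x z) (hJ : IsOpen J)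
    (hJint : J.OrdConnected) (hr : 1 ≤ r) (hc : 0 < c) {s : ℝ} (hs : s ∈ J) :
    HasDerivAt z (x s * denomV n m r k (z s) / r) s :=
  (hxz.deriv_z_eq_zero_or hJ hr hs).resolve_left (hxz.deriv_z_ne_zero hJ hJint hr hc hs) ▸
    (hxz.differentiable s hs).hasDerivAt

/-- The function `φ² h² x² D(z) = r φ² h² x z'` is constant, `D` being the denominator of `v`. -/
theorem exists_const (hxz : IsImplicitPair n m r k c J V x z) (hJ : IsOpen J)
    (hJint : J.OrdConnected) (hr : 1 ≤ r) (hc : 0 < c) {φ h : ℝ → ℝ}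
    (hφ : ∀ s ∈ J, HasDerivAt φ (φ s * (k * x s)) s)
    (hh : ∀ s ∈ J, HasDerivAt h (h s * (x s * z s)) s) :
    ∃ μ, ∀ s ∈ J, φ s ^ 2 * h s ^ 2 * x s ^ 2 * denomV n m r k (z s) = μ := by
  -- Only a base point of `J` is needed here.
  obtain ⟨s₀, hs₀, -⟩ := hxz.nonconstant
  have hr' : (r : ℝ) ≠ 0 := by positivity
  have key : ∀ s ∈ J,
      HasDerivAt (fun s => φ s ^ 2 * h s ^ 2 * x s ^ 2 * denomV n m r k (z s)) 0 s := by
    intro s hs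
    have hx := hxz.hasDerivAt_x hJ hs
    have hz := hxz.hasDerivAt_z hJ hJint hr hc hs
    have hD : HasDerivAt (fun s => denomV n m r k (z s)) _ s :=
      ((((hz.pow 2).const_mul ((r : ℝ) * (r - 1))).sub
        (hz.const_mul (2 * r * (k + coefA n m k)))).add_const (coefA n m k ^ 2)).sub_const
        (coefB n m k)
    -- The logarithmic derivatives of the four factors are $2kx$, $2xz$, $2x(a-rz)$ and
    -- $2x((r-1)z-k-a)$; they add up to zero.
    refine (((((hφ s hs).pow 2).mul ((hh s hs).pow 2)).mul (hx.pow 2)).mul hD).congr_deriv ?_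
    simp
    field_simp
    ring
  refine ⟨_, fun s hs => hJ.is_const_of_deriv_eq_zero hJint.isPreconnected
      (fun u hu => (key u hu).differentiableAt.differentiableWithinAt)
      (fun u hu => (key u hu).deriv) hs hs₀⟩

end IsImplicitPair

end ImplicitPair

/-! ### Metrics on manifolds read in preferred charts. -/

section ChartExpressions

open Filter Topology Set

variable {E : Type*} [NormedAddCommGroup E] [NormedSpace ℝ E]
  {H : Type*} [TopologicalSpace H]
  {E' : Type*} [NormedAddCommGroup E'] [NormedSpace ℝ E']
  {H' : Type*} [TopologicalSpace H']
  {I : ModelWithCorners ℝ E H} {I' : ModelWithCorners ℝ E' H'}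
  {M : Type*} [TopologicalSpace M] [ChartedSpace H M]
  {N : Type*} [TopologicalSpace N] [ChartedSpace H' N]

@[simp]
theorem pullbackField_apply (Φ : M → N) (g : BilinField I' N) (p : M) (u v : E) :
    pullbackField I I' Φ g p u v
      = g (Φ p) (tangentDeriv I I' Φ p u) (tangentDeriv I I' Φ p v) := by
  simp [pullbackField]

theorem tangentDeriv_fst (p : M × N) :
    tangentDeriv (I.prod I') I (Prod.fst : M × N → M) p = .fst ℝ E E' := mfderiv_fst

theorem tangentDeriv_snd (p : M × N) :
    tangentDeriv (I.prod I') I' (Prod.snd : M × N → N) p = .snd ℝ E E' := mfderiv_snd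

@[simp]
theorem warpedMetric_apply (gB : BilinField I M) (f : M → ℝ) (gF : BilinField I' N)
    (p : M × N) (u v : E × E') :
    warpedMetric I I' gB f gF p u v = gB p.1 u.1 v.1 + f p.1 ^ 2 * gF p.2 u.2 v.2 := by
  simp [warpedMetric, tangentDeriv_fst, tangentDeriv_snd]

/-- Tangent vectors at `p` are already written in the preferred chart at `p`, so no change of
coordinates remains in the Ricci tensor. -/
theorem tangentDeriv_extChartAt_self [IsManifold I 1 M] (p : M) :
    tangentDeriv I 𝓘(ℝ, E) (extChartAt I p) p = .id ℝ E := by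
  refine ((hasMFDerivAt_extChartAt (I := I) (mem_chart_source H p)).mfderiv.trans
    (mfderiv_chartAt_eq_tangentCoordChange (I := I) (mem_chart_source H p))).trans ?_
  ext v
  exact tangentCoordChange_self (mem_extChartAt_source p)

theorem ricci_eq [IsManifold I 1 M] (g : BilinField I M) (p : M) (v w : E) :
    ricci I g p v w = localRicci (coordField I g p) (extChartAt I p p) v w := by
  simp only [ricci, tangentDeriv_extChartAt_self, ContinuousLinearMap.id_apply]

variable [I.Boundaryless] [I'.Boundaryless]

theorem mdifferentiableAt_extChartAt_symm [IsManifold I 1 M] {p : M} {y : E}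
    (hy : y ∈ (extChartAt I p).target) : MDifferentiableAt 𝓘(ℝ, E) I (extChartAt I p).symm y := by
  have := mdifferentiableWithinAt_extChartAt_symm hy
  rwa [I.range_eq_univ, mdifferentiableWithinAt_univ] at this

theorem isInvertible_tangentDeriv_extChartAt_symm [IsManifold I 1 M] {p : M} {y : E}
    (hy : y ∈ (extChartAt I p).target) :
    (tangentDeriv 𝓘(ℝ, E) I (extChartAt I p).symm y).IsInvertible := by
  have := isInvertible_mfderivWithin_extChartAt_symm hy
  rwa [I.range_eq_univ, mfderivWithin_univ] at this

theorem tangentDeriv_extChartAt_symm_self [IsManifold I 1 M] (p : M) :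
    tangentDeriv 𝓘(ℝ, E) I (extChartAt I p).symm (extChartAt I p p) = .id ℝ E := by
  have h1 : tangentDeriv 𝓘(ℝ, E) I (extChartAt I p).symm (extChartAt I p p)
      ∘L tangentDeriv I 𝓘(ℝ, E) (extChartAt I p) p = .id ℝ E := by
    have := mfderivWithin_extChartAt_symm_comp_mfderiv_extChartAt'
      (mem_extChartAt_source (I := I) p)
    rwa [I.range_eq_univ, mfderivWithin_univ] at this
  rw [tangentDeriv_extChartAt_self] at h1
  exact h1

theorem coordField_self [IsManifold I 1 M] (g : BilinField I M) (p : M) :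
    coordField I g p (extChartAt I p p) = g p := by
  ext u v
  simp only [coordField, pullbackField_apply, tangentDeriv_extChartAt_symm_self,
    extChartAt_to_inv, ContinuousLinearMap.id_apply]

/-- The preferred chart of a product is the product chart, and the projections read in it are linear
projections. The equality holds on the whole chart target, so it can be differentiated. -/
theorem coordField_warpedMetric [IsManifold I 1 M] [IsManifold I' 1 N]
    (gB : BilinField I M) (f : M → ℝ) (gF : BilinField I' N) (p : M × N) {y : E × E'}
    (hy : y ∈ (extChartAt (I.prod I') p).target) :
    coordField (I.prod I') (warpedMetric I I' gB f gF) p y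
      = warpedForm (coordField I gB p.1) (f ∘ (extChartAt I p.1).symm)
        (coordField I' gF p.2) y := by
  have hy' : y.1 ∈ (extChartAt I p.1).target ∧ y.2 ∈ (extChartAt I' p.2).target := by
    rwa [extChartAt_prod] at hy
  have hd := mdifferentiableAt_extChartAt_symm hy
  have h1 : (tangentDeriv (I.prod I') I Prod.fst ((extChartAt (I.prod I') p).symm y)) ∘L
      tangentDeriv 𝓘(ℝ, E × E') (I.prod I') (extChartAt (I.prod I') p).symm y
      = tangentDeriv 𝓘(ℝ, E) I (extChartAt I p.1).symm y.1 ∘L .fst ℝ E E' := by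
    have e1 := mfderiv_comp y (mdifferentiableAt_fst
      (x := (extChartAt (I.prod I') p).symm y)) hd
    have e2 := mfderiv_comp (I := 𝓘(ℝ, E × E')) (I' := 𝓘(ℝ, E)) y
      (f := ContinuousLinearMap.fst ℝ E E')
      (mdifferentiableAt_extChartAt_symm hy'.1)
      (ContinuousLinearMap.fst ℝ E E').mdifferentiableAt
    rw [ContinuousLinearMap.mfderiv_eq] at e2
    refine e1.symm.trans (Eq.trans ?_ e2)
    rw [extChartAt_prod]
    rfl
  have h2 : (tangentDeriv (I.prod I') I' Prod.snd ((extChartAt (I.prod I') p).symm y)) ∘L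
      tangentDeriv 𝓘(ℝ, E × E') (I.prod I') (extChartAt (I.prod I') p).symm y
      = tangentDeriv 𝓘(ℝ, E') I' (extChartAt I' p.2).symm y.2 ∘L .snd ℝ E E' := by
    have e1 := mfderiv_comp y (mdifferentiableAt_snd
      (x := (extChartAt (I.prod I') p).symm y)) hd
    have e2 := mfderiv_comp (I := 𝓘(ℝ, E × E')) (I' := 𝓘(ℝ, E')) y
      (f := ContinuousLinearMap.snd ℝ E E')
      (mdifferentiableAt_extChartAt_symm hy'.2)
      (ContinuousLinearMap.snd ℝ E E').mdifferentiableAt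
    rw [ContinuousLinearMap.mfderiv_eq] at e2
    refine e1.symm.trans (Eq.trans ?_ e2)
    rw [extChartAt_prod]
    rfl
  have h1' := fun u => congrArg (fun L => L u) h1
  have h2' := fun u => congrArg (fun L => L u) h2
  simp only [tangentDeriv_fst, tangentDeriv_snd, ContinuousLinearMap.comp_apply,
    ContinuousLinearMap.coe_fst', ContinuousLinearMap.coe_snd'] at h1' h2'
  have e3 : (extChartAt (I.prod I') p).symm y
      = ((extChartAt I p.1).symm y.1, (extChartAt I' p.2).symm y.2) := by
    rw [extChartAt_prod]; rfl
  refine ContinuousLinearMap.ext fun u => ContinuousLinearMap.ext fun v => ?_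
  simp only [coordField, pullbackField_apply, warpedMetric_apply, warpedForm_apply, h1', h2', e3,
    Function.comp_apply]

/-- An injective map to the dual is bijective by dimension, and continuous with its inverse. -/
theorem isInvertible_of_nondegenerate [FiniteDimensional ℝ E] {B : E →L[ℝ] E →L[ℝ] ℝ}
    (h : ∀ u, (∀ v, B u v = 0) → u = 0) : B.IsInvertible := by
  have hinj : Function.Injective B := (injective_iff_map_eq_zero B).2 fun u hu =>
    h u fun v => by simp [hu]
  have hdim : Module.finrank ℝ E = Module.finrank ℝ (E →L[ℝ] ℝ) := by
    rw [← (LinearMap.toContinuousLinearMap (𝕜 := ℝ) (E := E) (F' := ℝ)).finrank_eq]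
    exact (Subspace.dual_finrank_eq).symm
  have : FiniteDimensional ℝ (E →L[ℝ] ℝ) :=
    (LinearMap.toContinuousLinearMap (𝕜 := ℝ) (E := E) (F' := ℝ)).finiteDimensional
  refine ⟨(LinearEquiv.ofInjectiveOfFinrankEq (B : E →ₗ[ℝ] E →L[ℝ] ℝ) hinj
    hdim).toContinuousLinearEquiv, ?_⟩
  ext; rfl

theorem IsSemiRiemannian.isMetricOn [FiniteDimensional ℝ E] [IsManifold I 1 M]
    {g : BilinField I M} (hg : IsSemiRiemannian I g) (p : M) :
    IsMetricOn (coordField I g p) (extChartAt I p).target where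
  isOpen := isOpen_extChartAt_target p
  symm y _ u v := by simpa [coordField] using hg.symm _ _ _
  isInvertible y hy := by
    have hT := isInvertible_tangentDeriv_extChartAt_symm hy
    refine isInvertible_of_nondegenerate fun u hu => ?_
    simp only [coordField, pullbackField_apply] at hu
    have h0 := hg.nondegenerate _ _ fun v => by
      obtain ⟨w, rfl⟩ := hT.surjective v
      exact hu w
    exact hT.injective (h0.trans (map_zero _).symm)
  contDiffOn := (hg.smooth p).of_le ENat.LEInfty.out

end ChartExpressions

/-! ### Index of orthogonal sums and positive multiples. -/

section Signature

open QuadraticMap QuadraticForm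

/-- Diagonalise both forms and count negative weights. -/
theorem sigNeg_prod {V W : Type*} [AddCommGroup V] [Module ℝ V] [FiniteDimensional ℝ V]
    [AddCommGroup W] [Module ℝ W] [FiniteDimensional ℝ W]
    (Q : QuadraticForm ℝ V) (Q' : QuadraticForm ℝ W) :
    sigNeg (Q.prod Q') = sigNeg Q + sigNeg Q' := by
  obtain ⟨w, hw⟩ := Q.equivalent_weightedSumSquares
  obtain ⟨w', hw'⟩ := Q'.equivalent_weightedSumSquares
  have e : Equivalent ((weightedSumSquares ℝ w).prod (weightedSumSquares ℝ w'))
      (weightedSumSquares ℝ (Sum.elim w w')) := by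
    refine ⟨⟨(LinearEquiv.sumPiEquivProdPi ℝ _ _ (fun _ => ℝ)).symm, fun x => ?_⟩⟩
    simp [weightedSumSquares_apply, Fintype.sum_sum_type, Equiv.sumPiEquivProdPi]
  rw [sigNeg_of_equiv_weightedSumSquares hw, sigNeg_of_equiv_weightedSumSquares hw',
    sigNeg_of_equiv_weightedSumSquares ((hw.prod hw').trans e)]
  have : {i | Sum.elim w w' i < 0} = Sum.inl '' {i | w i < 0} ∪ Sum.inr '' {i | w' i < 0} := by
    ext i; rcases i with i | i <;> simp
  rw [this, Set.ncard_union_eq, Set.ncard_image_of_injective _ Sum.inl_injective,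
    Set.ncard_image_of_injective _ Sum.inr_injective]
  rw [Set.disjoint_left]
  rintro _ ⟨i, -, rfl⟩ ⟨j, -, h⟩
  simp at h

/-- Multiplication by $\sqrt c$ is an isometry from $cQ$ to $Q$. -/
theorem sigNeg_smul {V : Type*} [AddCommGroup V] [Module ℝ V] [FiniteDimensional ℝ V]
    (Q : QuadraticForm ℝ V) {c : ℝ} (hc : 0 < c) : sigNeg (c • Q) = sigNeg Q := by
  refine Equivalent.sigNeg_eq ⟨⟨LinearEquiv.smulOfNeZero ℝ V √c (by positivity), fun x => ?_⟩⟩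
  simp [QuadraticMap.map_smul, Real.mul_self_sqrt hc.le]

end Signature

/-! ### Warped products of semi-Riemannian manifolds. -/

section SemiRiemannian

open Filter Topology Set

variable {E : Type*} [NormedAddCommGroup E] [NormedSpace ℝ E] [FiniteDimensional ℝ E]
  {H : Type*} [TopologicalSpace H]
  {E' : Type*} [NormedAddCommGroup E'] [NormedSpace ℝ E'] [FiniteDimensional ℝ E']
  {H' : Type*} [TopologicalSpace H']
  {I : ModelWithCorners ℝ E H} {I' : ModelWithCorners ℝ E' H'}
  {M : Type*} [TopologicalSpace M] [ChartedSpace H M]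
  {N : Type*} [TopologicalSpace N] [ChartedSpace H' N]
  [I.Boundaryless] [I'.Boundaryless]

theorem IsSemiRiemannian.warpedMetric [IsManifold I 1 M] [IsManifold I' 1 N]
    {gB : BilinField I M} {f : M → ℝ} {gF : BilinField I' N} (hB : IsSemiRiemannian I gB)
    (hF : IsSemiRiemannian I' gF) (hf0 : ∀ p, f p ≠ 0)
    (hf : ∀ p, ContDiffOn ℝ ∞ (f ∘ (extChartAt I p).symm) (extChartAt I p).target) :
    IsSemiRiemannian (I.prod I') (warpedMetric I I' gB f gF) where
  symm p u v := by simp [hB.symm _ u.1, hF.symm _ u.2]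
  nondegenerate p u hu := by
    simp only [warpedMetric_apply] at hu
    ext1
    · exact hB.nondegenerate p.1 _ fun v => by simpa using hu (v, 0)
    · exact hF.nondegenerate p.2 _ fun v => by simpa [hf0] using hu (0, v)
  smooth p := by
    refine ((contDiffOn_warpedForm (hB.smooth p.1) (hf p.1) (hF.smooth p.2)).mono ?_).congr
      fun y hy => coordField_warpedMetric gB f gF p hy
    rw [extChartAt_prod]
    exact subset_rfl
  constant_index := by
    obtain ⟨ν, hν⟩ := hB.constant_index
    obtain ⟨ν', hν'⟩ := hF.constant_index
    refine ⟨ν + ν', fun p => ?_⟩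
    rw [← hν p.1, ← hν' p.2,
      ← sigNeg_smul (LinearMap.BilinMap.toQuadraticMap (gF p.2).toLinearMap₁₂)
        (sq_pos_of_ne_zero (hf0 p.1)), ← sigNeg_prod]
    congr 1
    ext u
    simp

end SemiRiemannian

/-! ### The strip and its conformal metric. -/

section Strip

open Filter Topology Set

variable {n : ℕ} {ε α : Fin n → ℝ} {J : Set ℝ} {hJ : IsOpen J} {φ : ℝ → ℝ}

/-- The covector `ξ = ∑ α_i x_i`. -/
noncomputable def xiCLM (α : Fin n → ℝ) : EuclideanSpace ℝ (Fin n) →L[ℝ] ℝ :=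
  ∑ i, α i • EuclideanSpace.proj i

theorem xiCLM_apply (x : EuclideanSpace ℝ (Fin n)) : xiCLM α x = xi α x := by
  simp [xiCLM, xi]

theorem pseudoEuclidean_apply (u v : EuclideanSpace ℝ (Fin n)) :
    pseudoEuclidean ε u v = ∑ i, ε i * (u i * v i) := by
  simp [pseudoEuclidean]

theorem pseudoEuclidean_symm (u v : EuclideanSpace ℝ (Fin n)) :
    pseudoEuclidean ε u v = pseudoEuclidean ε v u := by
  simp only [pseudoEuclidean_apply, mul_comm]

theorem pseudoEuclidean_nondegenerate (hε : ∀ i, ε i = 1 ∨ ε i = -1)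
    (u : EuclideanSpace ℝ (Fin n)) (hu : ∀ v, pseudoEuclidean ε u v = 0) : u = 0 := by
  ext i
  have := hu (EuclideanSpace.single i 1)
  rw [pseudoEuclidean_apply, Finset.sum_eq_single i] at this
  · rcases hε i with h | h <;> simpa [h] using this
  · intro j _ hj; simp [hj]
  · simp

theorem isInvertible_pseudoEuclidean (hε : ∀ i, ε i = 1 ∨ ε i = -1) :
    (pseudoEuclidean ε).IsInvertible :=
  isInvertible_of_nondegenerate (pseudoEuclidean_nondegenerate hε)

/-- Charts of an open subset of a vector space are restrictions of the identity. -/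
theorem val_extChartAt_strip_symm (p : strip α J hJ) {y : EuclideanSpace ℝ (Fin n)}
    (hy : y ∈ (extChartAt (𝓡 n) p).target) : ((extChartAt (𝓡 n) p).symm y).1 = y := by
  have h := (chartAt (EuclideanSpace ℝ (Fin n)) p.1).subtypeRestr_symm_apply
    (U := strip α J hJ) ⟨p⟩ (y := y) (by simpa [TopologicalSpace.Opens.chartAt_eq] using hy)
  simp only [TopologicalSpace.Opens.chartAt_eq, mfld_simps] at h ⊢
  exact h

theorem xi_mem_of_mem_target (p : strip α J hJ) {y : EuclideanSpace ℝ (Fin n)}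
    (hy : y ∈ (extChartAt (𝓡 n) p).target) : xi α y ∈ J := by
  have := ((extChartAt (𝓡 n) p).symm y).2
  rwa [SetLike.mem_coe.symm.trans Iff.rfl, val_extChartAt_strip_symm p hy] at this

theorem coordField_conformalMetric (p : strip α J hJ) {y : EuclideanSpace ℝ (Fin n)}
    (hy : y ∈ (extChartAt (𝓡 n) p).target) :
    coordField (𝓡 n) (conformalMetric ε α J hJ φ) p y
      = conformalForm (pseudoEuclidean ε) (xiCLM α) φ y := by
  have h1 : tangentDeriv (𝓡 n) (𝓡 n) (Subtype.val : strip α J hJ → EuclideanSpace ℝ (Fin n))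
      ((extChartAt (𝓡 n) p).symm y) ∘L
      tangentDeriv 𝓘(ℝ, EuclideanSpace ℝ (Fin n)) (𝓡 n) (extChartAt (𝓡 n) p).symm y
      = .id ℝ _ := by
    have hd : MDifferentiableAt (𝓡 n) (𝓡 n)
        (Subtype.val : strip α J hJ → EuclideanSpace ℝ (Fin n)) ((extChartAt (𝓡 n) p).symm y) :=
      (contMDiff_subtype_val (n := 1)).mdifferentiable one_ne_zero _
    refine (mfderiv_comp y hd (mdifferentiableAt_extChartAt_symm hy)).symm.trans ?_
    have : (Subtype.val ∘ (extChartAt (𝓡 n) p).symm) =ᶠ[𝓝 y] id := by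
      filter_upwards [(isOpen_extChartAt_target p).mem_nhds hy] with y' hy'
        using val_extChartAt_strip_symm p hy'
    rw [this.mfderiv_eq, mfderiv_id]
    rfl
  have h1' := fun u => congrArg (fun L => L u) h1
  simp only [ContinuousLinearMap.comp_apply, ContinuousLinearMap.id_apply] at h1'
  refine ContinuousLinearMap.ext fun u => ContinuousLinearMap.ext fun v => ?_
  simp only [coordField, conformalMetric, pullbackField_apply, h1', val_extChartAt_strip_symm p hy,
    conformalForm, xiCLM_apply]

theorem conformalMetric_apply (p : strip α J hJ) :
    conformalMetric ε α J hJ φ p = (1 / φ (xi α p) ^ 2) • pseudoEuclidean ε := by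
  rw [← coordField_self (I := 𝓡 n) (conformalMetric ε α J hJ φ) p,
    coordField_conformalMetric p (mem_extChartAt_target p), conformalForm, xiCLM_apply]
  rfl

theorem isSemiRiemannian_conformalMetric (hε : ∀ i, ε i = 1 ∨ ε i = -1)
    (hφ : ContDiffOn ℝ ∞ φ J) (hφ0 : ∀ s ∈ J, φ s ≠ 0) :
    IsSemiRiemannian (𝓡 n) (conformalMetric ε α J hJ φ) where
  symm p u v := by simp [conformalMetric_apply, pseudoEuclidean_symm u]
  nondegenerate p u hu := by
    have h0 := hφ0 _ p.2
    refine pseudoEuclidean_nondegenerate hε u fun v => ?_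
    simpa [conformalMetric_apply, h0] using hu v
  smooth p := by
    refine ((contDiffOn_conformalForm (ξ := xiCLM α) hφ hφ0).mono fun y hy => ?_).congr
      fun y hy => coordField_conformalMetric p hy
    simpa [xiCLM_apply] using xi_mem_of_mem_target p hy
  constant_index := by
    refine ⟨sigNeg (LinearMap.BilinMap.toQuadraticMap (pseudoEuclidean ε).toLinearMap₁₂),
      fun p => ?_⟩
    rw [conformalMetric_apply, ← sigNeg_smul (LinearMap.BilinMap.toQuadraticMap
      (pseudoEuclidean ε).toLinearMap₁₂) (one_div_pos.2 (sq_pos_of_ne_zero (hφ0 _ p.2)))]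
    congr 1

end Strip

/-! ### The field equations on the base. -/

section RicciFlat

open Filter Topology Set Module

variable {E : Type*} [NormedAddCommGroup E] [NormedSpace ℝ E] [FiniteDimensional ℝ E]
  {F : Type*} [NormedAddCommGroup F] [NormedSpace ℝ F] [FiniteDimensional ℝ F]
  {η : E →L[ℝ] E →L[ℝ] ℝ} {ξ : E →L[ℝ] ℝ} {ν : E} {e : ℝ}
  {C : F → F →L[ℝ] F →L[ℝ] ℝ} {T : Set F}
  {J : Set ℝ} {n m r : ℕ} {k : ℝ} {x z f φ h : ℝ → ℝ}

/-- Both equations on $B$ become polynomial identities in $x$, $z$, $f$, $\varphi$, $h$ once $x'$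
and $z'$ are substituted. The fibre enters only through its vanishing Ricci tensor and its
dimension. -/
theorem localHessian_warpedForm_conformalForm (hn : finrank ℝ E = n) (hm : finrank ℝ F = m)
    (hr : 1 ≤ r) (hη : ∀ u v, η u v = η v u) (hη' : η.IsInvertible)
    (hν : ∀ w, η ν w = ξ w) (he : ξ ν = e) (hC : IsMetricOn C T) (hJ : IsOpen J)
    (hf : ContDiffOn ℝ 2 f J) (hφ : ContDiffOn ℝ 2 φ J) (hh : ContDiffOn ℝ 2 h J)
    (hf0 : ∀ s ∈ J, f s ≠ 0) (hφ0 : ∀ s ∈ J, φ s ≠ 0) (hh0 : ∀ s ∈ J, h s ≠ 0)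
    (hf' : ∀ s ∈ J, HasDerivAt f (f s * x s) s)
    (hφ' : ∀ s ∈ J, HasDerivAt φ (φ s * (k * x s)) s)
    (hh' : ∀ s ∈ J, HasDerivAt h (h s * (x s * z s)) s)
    (hx : ∀ s ∈ J, HasDerivAt x (x s ^ 2 * (coefA n m k - r * z s)) s)
    (hz : ∀ s ∈ J, HasDerivAt z (x s * denomV n m r k (z s) / r) s)
    {p : E × F} (hp : p ∈ (ξ ⁻¹' J) ×ˢ T) (hC0 : ∀ b c, localRicci C p.2 b c = 0) :
    (∀ Y Z, localRicci (warpedForm (conformalForm η ξ φ) (fun y => f (ξ y)) C) p Y Z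
      = r / h (ξ p.1) * localHessian (warpedForm (conformalForm η ξ φ) (fun y => f (ξ y)) C)
          (fun q => h (ξ q.1)) p Y Z) ∧
    h (ξ p.1) * localLaplacian (warpedForm (conformalForm η ξ φ) (fun y => f (ξ y)) C)
        (fun q => h (ξ q.1)) p
      + (r - 1) * localGradSq (warpedForm (conformalForm η ξ φ) (fun y => f (ξ y)) C)
        (fun q => h (ξ q.1)) p
      = e / r * (φ (ξ p.1) ^ 2 * h (ξ p.1) ^ 2 * x (ξ p.1) ^ 2
          * denomV n m r k (z (ξ p.1))) := by
  have hA := isMetricOn_conformalForm (ξ := ξ) hη hη' hJ hφ hφ0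
  have hy : ξ p.1 ∈ J := hp.1
  have hfS := contDiffOn_comp_covector (ξ := ξ) hf
  have hhS := contDiffOn_comp_covector (ξ := ξ) hh
  have hfS0 : ∀ y ∈ ξ ⁻¹' J, f (ξ y) ≠ 0 := fun y hy => hf0 _ hy
  have hκ := (hx _ hy).const_mul k
  have hf'' := (hf' _ hy).mul (hx _ hy)
  have hh'' := (hh' _ hy).mul ((hx _ hy).mul (hz _ hy))
  have hφ1 := hφ0 _ hy
  have hf1 := hf0 _ hy
  have hh1 := hh0 _ hy
  have hr' : (r : ℝ) ≠ 0 := by positivity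
  have hhd : DifferentiableAt ℝ (fun y => h (ξ y)) p.1 :=
    (hhS.contDiffAt (hA.isOpen.mem_nhds hy)).differentiableAt (by norm_num)
  constructor
  · intro Y Z
    rw [hA.localRicci_warpedForm hC hfS hfS0 hp, hC0,
      hA.localHessian_warpedForm hC hfS hfS0 hp hhS,
      localRicci_conformalForm hη hη' hJ hφ hφ0 hφ' hν he hy hκ,
      localHessian_conformalForm hη hη' hJ hφ hφ0 hφ' hν he hy hf' hf'',
      localHessian_conformalForm hη hη' hJ hφ hφ0 hφ' hν he hy hh' hh'',
      localLaplacian_conformalForm hη hη' hJ hφ hφ0 hφ' hν he hy hf' hf'',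
      localGradSq_eq, localGrad_conformalForm hη' hν hφ1 (hf' _ hy),
      fderiv_comp_covector (hf' _ hy), fderiv_comp_covector (hh' _ hy), hn, hm]
    -- The $\eta$ and $C$ coefficients vanish by $x'=x^2(a-rz)$, and the $\xi\otimes\xi$ coefficient
    -- by $rz'=xD(z)$.
    simp [he, denomV, coefA, coefB]
    field_simp
    ring
  · rw [hA.localLaplacian_warpedForm hC hfS hfS0 hp hhS, hA.localGradSq_warpedForm hC hfS0 hp hhd,
      localLaplacian_conformalForm hη hη' hJ hφ hφ0 hφ' hν he hy hh' hh'',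
      localGradSq_eq, localGrad_conformalForm hη' hν hφ1 (hf' _ hy),
      localGrad_conformalForm hη' hν hφ1 (hh' _ hy),
      fderiv_comp_covector (hh' _ hy), hn, hm]
    -- After division by $e\varphi^2h^2$ the left side is $(xz)'-ax^2z+rx^2z^2=xz'$.
    simp [he, denomV, coefA, coefB]
    field_simp
    ring

end RicciFlat

/-! ### Chart expressions on $B$. -/

section WarpedStrip

open Filter Topology Set

variable {n m : ℕ} {ε α : Fin n → ℝ} {J : Set ℝ} {hJ : IsOpen J} {φ f h : ℝ → ℝ}
  {F : Type*} [TopologicalSpace F] [ChartedSpace (EuclideanSpace ℝ (Fin m)) F]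

theorem extChartAt_prod_mem {E E' H H' M N : Type*} [NormedAddCommGroup E] [NormedSpace ℝ E]
    [TopologicalSpace H] [NormedAddCommGroup E'] [NormedSpace ℝ E'] [TopologicalSpace H']
    {I : ModelWithCorners ℝ E H} {I' : ModelWithCorners ℝ E' H'} [TopologicalSpace M]
    [ChartedSpace H M] [TopologicalSpace N] [ChartedSpace H' N] {p : M × N} {y : E × E'} :
    y ∈ (extChartAt (I.prod I') p).target
      ↔ y.1 ∈ (extChartAt I p.1).target ∧ y.2 ∈ (extChartAt I' p.2).target := by
  rw [extChartAt_prod]; rfl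

theorem comp_extChartAt_strip_symm (p : strip α J hJ) {y : EuclideanSpace ℝ (Fin n)}
    (hy : y ∈ (extChartAt (𝓡 n) p).target) :
    ((fun x : strip α J hJ => f (xi α x)) ∘ (extChartAt (𝓡 n) p).symm) y = f (xiCLM α y) := by
  rw [Function.comp_apply, val_extChartAt_strip_symm p hy, xiCLM_apply]

theorem baseFun_comp_extChartAt_symm (p : strip α J hJ × F)
    {y : EuclideanSpace ℝ (Fin n) × EuclideanSpace ℝ (Fin m)}
    (hy : y ∈ (extChartAt ((𝓡 n).prod (𝓡 m)) p).target) :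
    (baseFun α J hJ h ∘ (extChartAt ((𝓡 n).prod (𝓡 m)) p).symm) y = h (xiCLM α y.1) := by
  rw [extChartAt_prod_mem] at hy
  rw [extChartAt_prod]
  exact comp_extChartAt_strip_symm p.1 hy.1

theorem coordField_baseMetric [IsManifold (𝓡 m) 1 F] (g : BilinField (𝓡 m) F)
    (p : strip α J hJ × F) {y : EuclideanSpace ℝ (Fin n) × EuclideanSpace ℝ (Fin m)}
    (hy : y ∈ (extChartAt ((𝓡 n).prod (𝓡 m)) p).target) :
    coordField ((𝓡 n).prod (𝓡 m)) (baseMetric ε α J hJ φ f g) p y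
      = warpedForm (conformalForm (pseudoEuclidean ε) (xiCLM α) φ) (fun y => f (xiCLM α y))
        (coordField (𝓡 m) g p.2) y := by
  have hy' := extChartAt_prod_mem.1 hy
  rw [baseMetric, coordField_warpedMetric _ _ _ _ hy, warpedForm, warpedForm,
    coordField_conformalMetric p.1 hy'.1, comp_extChartAt_strip_symm p.1 hy'.1]

end WarpedStrip

/-! ### Assembly of the two warped products. -/

theorem mainTheorem11 {n m r : ℕ} (hn : 3 ≤ n) (hm : 1 ≤ m) (hr : 1 ≤ r)
    -- the pseudo-Euclidean space and the direction `α`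
    (ε : Fin n → ℝ) (hε : ∀ i, ε i = 1 ∨ ε i = -1)
    (α : Fin n → ℝ) (i₀ : Fin n) (hα : ∑ i, ε i * α i ^ 2 = ε i₀)
    -- the implicit solutions on an open interval `J`
    (k c : ℝ) (hk : 0 < k) (hc : 0 < c)
    (J : Set ℝ) (hJ : IsOpen J) (hJint : J.OrdConnected)
    (V x z : ℝ → ℝ) (hxz : IsImplicitPair n m r k c J V x z)
    (f φ h : ℝ → ℝ)
    (hf : ContDiffOn ℝ ∞ f J) (hφ : ContDiffOn ℝ ∞ φ J) (hh : ContDiffOn ℝ ∞ h J)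
    (hfpos : ∀ s ∈ J, 0 < f s) (hφne : ∀ s ∈ J, φ s ≠ 0) (hhpos : ∀ s ∈ J, 0 < h s)
    (hfx : ∀ s ∈ J, deriv f s / f s = x s)
    (hφx : ∀ s ∈ J, deriv φ s / φ s = k * x s)
    (hhx : ∀ s ∈ J, deriv h s / h s = x s * z s)
    -- the Ricci-flat fibre `F₁` of dimension `m`
    {F₁ : Type*} [TopologicalSpace F₁] [ChartedSpace (EuclideanSpace ℝ (Fin m)) F₁]
    [IsManifold (𝓡 m) ∞ F₁]
    (g₁ : BilinField (𝓡 m) F₁) (hg₁ : IsSemiRiemannian (𝓡 m) g₁)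
    (hflat₁ : IsRicciFlat (𝓡 m) g₁) :
    ∃ μ : ℝ,
      (∀ p, baseFun α J hJ h p * laplacian ((𝓡 n).prod (𝓡 m)) (baseMetric ε α J hJ φ f g₁)
          (baseFun α J hJ h) p
        + ((r : ℝ) - 1) * gradSq ((𝓡 n).prod (𝓡 m)) (baseMetric ε α J hJ φ f g₁)
          (baseFun α J hJ h) p = μ) ∧
      ∀ (F₂ : Type*) [TopologicalSpace F₂] [ChartedSpace (EuclideanSpace ℝ (Fin r)) F₂]
        [IsManifold (𝓡 r) ∞ F₂] (g₂ : BilinField (𝓡 r) F₂),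
        IsSemiRiemannian (𝓡 r) g₂ → IsEinsteinWith (𝓡 r) g₂ μ →
        IsSemiRiemannian (((𝓡 n).prod (𝓡 m)).prod (𝓡 r))
          (warpedMetric ((𝓡 n).prod (𝓡 m)) (𝓡 r) (baseMetric ε α J hJ φ f g₁)
            (baseFun α J hJ h) g₂) ∧
        IsRicciFlat (((𝓡 n).prod (𝓡 m)).prod (𝓡 r))
          (warpedMetric ((𝓡 n).prod (𝓡 m)) (𝓡 r) (baseMetric ε α J hJ φ f g₁)
            (baseFun α J hJ h) g₂) := by
  have h1 : IsManifold (𝓡 m) 1 F₁ := .of_le (n := ∞) ENat.LEInfty.out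
  have logDeriv : ∀ {u v : ℝ → ℝ}, ContDiffOn ℝ ∞ u J → (∀ s ∈ J, u s ≠ 0) →
      (∀ s ∈ J, deriv u s / u s = v s) → ∀ s ∈ J, HasDerivAt u (u s * v s) s := by
    intro u v hu hu0 huv s hs
    have hd := ((hu.contDiffAt (hJ.mem_nhds hs)).differentiableAt (by simp)).hasDerivAt
    rwa [← huv s hs, mul_div_cancel₀ _ (hu0 s hs)]
  have hf0 : ∀ s ∈ J, f s ≠ 0 := fun s hs => (hfpos s hs).ne'
  have hh0 : ∀ s ∈ J, h s ≠ 0 := fun s hs => (hhpos s hs).ne'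
  have hf' := logDeriv hf hf0 hfx
  have hφ' := logDeriv hφ hφne hφx
  have hh' := logDeriv hh hh0 hhx
  have hx : ∀ s ∈ J, _ := fun s hs => hxz.hasDerivAt_x hJ hs
  have hz : ∀ s ∈ J, _ := fun s hs => hxz.hasDerivAt_z hJ hJint hr hc hs
  obtain ⟨μ, hμ⟩ := hxz.exists_const hJ hJint hr hc hφ' hh'
  -- The metric dual of `α`: lowering its index gives back `α` because $\varepsilon_i^2=1$.
  let ν : EuclideanSpace ℝ (Fin n) := WithLp.toLp 2 fun i => ε i * α i
  have hεε : ∀ i, ε i * ε i = 1 := fun i => by rcases hε i with h | h <;> simp [h]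
  have hν : ∀ w, pseudoEuclidean ε ν w = xiCLM α w := fun w => by
    rw [pseudoEuclidean_apply, xiCLM_apply, xi]
    refine Finset.sum_congr rfl fun i _ => ?_
    linear_combination α i * w i * hεε i
  have he : xiCLM α ν = ε i₀ := by
    rw [← hα, xiCLM_apply, xi]
    refine Finset.sum_congr rfl fun i _ => ?_
    change α i * (ε i * α i) = _
    ring
  have h2 : (2 : WithTop ℕ∞) ≤ ∞ := ENat.LEInfty.out
  have local_eq : ∀ p : strip α J hJ × F₁, _ := fun p =>
    have hp := extChartAt_prod_mem.1 (mem_extChartAt_target (I := (𝓡 n).prod (𝓡 m)) p)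
    localHessian_warpedForm_conformalForm (n := n) (m := m) (ξ := xiCLM α)
      (p := extChartAt ((𝓡 n).prod (𝓡 m)) p p) finrank_euclideanSpace_fin
      finrank_euclideanSpace_fin hr pseudoEuclidean_symm (isInvertible_pseudoEuclidean hε) hν he
      (hg₁.isMetricOn p.2) hJ (hf.of_le h2) (hφ.of_le h2) (hh.of_le h2) hf0 hφne hh0 hf' hφ' hh'
      hx hz ⟨by simpa [xiCLM_apply] using xi_mem_of_mem_target p.1 hp.1, hp.2⟩
      (fun b c => (ricci_eq g₁ p.2 b c).symm.trans (hflat₁ _ _ _))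
  have base_ev : ∀ p : strip α J hJ × F₁, _ := fun p =>
    Filter.eventually_of_mem (extChartAt_target_mem_nhds (I := (𝓡 n).prod (𝓡 m)) p)
      fun y hy => coordField_baseMetric (ε := ε) (φ := φ) (f := f) g₁ p hy
  have fun_ev : ∀ p : strip α J hJ × F₁, _ := fun p =>
    Filter.eventually_of_mem (extChartAt_target_mem_nhds (I := (𝓡 n).prod (𝓡 m)) p)
      fun y hy => baseFun_comp_extChartAt_symm (h := h) p hy
  have hbase : IsSemiRiemannian ((𝓡 n).prod (𝓡 m)) (baseMetric ε α J hJ φ f g₁) := by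
    refine (isSemiRiemannian_conformalMetric hε hφ hφne).warpedMetric hg₁
      (fun p => hf0 _ p.2) fun p => ?_
    refine ((contDiffOn_comp_covector (ξ := xiCLM α) hf).mono fun y hy => ?_).congr
      fun y hy => comp_extChartAt_strip_symm p hy
    simpa [xiCLM_apply] using xi_mem_of_mem_target p hy
  have hbaseFun : ∀ p : strip α J hJ × F₁,
      ContDiffOn ℝ ∞ (baseFun α J hJ h ∘ (extChartAt ((𝓡 n).prod (𝓡 m)) p).symm)
        (extChartAt ((𝓡 n).prod (𝓡 m)) p).target := fun p => by
    refine (((contDiffOn_comp_covector (ξ := xiCLM α) hh).comp contDiffOn_fst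
      (s := (extChartAt ((𝓡 n).prod (𝓡 m)) p).target) fun y hy => ?_)).congr
      fun y hy => baseFun_comp_extChartAt_symm p hy
    simpa [xiCLM_apply] using xi_mem_of_mem_target p.1 (extChartAt_prod_mem.1 hy).1
  have hlap : ∀ p, baseFun α J hJ h p * laplacian ((𝓡 n).prod (𝓡 m))
        (baseMetric ε α J hJ φ f g₁) (baseFun α J hJ h) p
      + ((r : ℝ) - 1) * gradSq ((𝓡 n).prod (𝓡 m)) (baseMetric ε α J hJ φ f g₁)
        (baseFun α J hJ h) p = ε i₀ / r * μ := fun p => by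
    have hval := (fun_ev p).self_of_nhds
    have hmem := extChartAt_prod_mem.1 (mem_extChartAt_target (I := (𝓡 n).prod (𝓡 m)) p)
    rw [Function.comp_apply, extChartAt_to_inv] at hval
    rw [laplacian, gradSq, localLaplacian_congr (base_ev p) (fun_ev p),
      localGradSq_congr (base_ev p) (fun_ev p), hval, (local_eq p).2, hμ]
    simpa [xiCLM_apply] using xi_mem_of_mem_target p.1 hmem.1
  -- The Einstein constant is the first integral scaled by $e/r$ with $e=\varepsilon_{i_0}$.
  refine ⟨ε i₀ / r * μ, hlap, ?_⟩
  intro F₂ _ _ _ g₂ hg₂ hE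
  have h1' : IsManifold (𝓡 r) 1 F₂ := .of_le (n := ∞) ENat.LEInfty.out
  have hh0' : ∀ p : strip α J hJ × F₁, baseFun α J hJ h p ≠ 0 := fun p => hh0 _ p.1.2
  refine ⟨hbase.warpedMetric hg₂ hh0' hbaseFun, fun p v w => ?_⟩
  have hmem := extChartAt_prod_mem.1
    (mem_extChartAt_target (I := ((𝓡 n).prod (𝓡 m)).prod (𝓡 r)) p)
  have ev : coordField _ (warpedMetric ((𝓡 n).prod (𝓡 m)) (𝓡 r) (baseMetric ε α J hJ φ f g₁)
      (baseFun α J hJ h) g₂) p =ᶠ[nhds (extChartAt (((𝓡 n).prod (𝓡 m)).prod (𝓡 r)) p p)] _ :=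
    Filter.eventually_of_mem (extChartAt_target_mem_nhds p)
      fun y hy => coordField_warpedMetric _ _ g₂ p hy
  have hlap' := hlap p.1
  have hval : baseFun α J hJ h p.1 = (baseFun α J hJ h ∘
      (extChartAt ((𝓡 n).prod (𝓡 m)) p.1).symm) (extChartAt ((𝓡 n).prod (𝓡 m)) p.1 p.1) := by
    rw [Function.comp_apply, extChartAt_to_inv]
  rw [laplacian, gradSq, hval] at hlap'
  rw [ricci_eq, localRicci_congr ev, (hbase.isMetricOn p.1).localRicci_warpedForm
    (hg₂.isMetricOn p.2) ((hbaseFun p.1).of_le h2) (fun y _ => hh0' _) hmem]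
  have hE' := hE p.2 v.2 w.2
  rw [ricci_eq, ← coordField_self (I := 𝓡 r) g₂ p.2] at hE'
  have hric := (local_eq p.1).1 v.1 w.1
  rw [← localRicci_congr (base_ev p.1), ← localHessian_congr (base_ev p.1) (fun_ev p.1),
    ← (fun_ev p.1).self_of_nhds] at hric
  rw [finrank_euclideanSpace_fin, extChartAt_prod]
  simp only [PartialEquiv.prod_coe]
  rw [hric, hE']
  -- The base terms cancel by `hric`; what is left is the Einstein constant minus the expression in
  -- `hlap'`, times $g_{F_2}$.
  linear_combination -(coordField (𝓡 r) g₂ p.2 (extChartAt (𝓡 r) p.2 p.2) v.2 w.2) * hlap'
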